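/- Consider the equation $F := D(u_t) - J(u, D(u)) = 0$ for a real function $u(t,x,y)$, where $D = D_x\circ D_y$, $J(a,b) = D_x(a)\,D_y(b) - D_y(a)\,D_x(b)$, and $D_t, D_x, D_y$ are the total derivatives on the jet space; thus $F = u_{txy} - u_x u_{xyy} + u_y u_{xxy}$. Let $U$ be an open convex subset of the space $\mathbb{R}^7$ of first-order jets $(t,x,y,u,u_t,u_x,u_y)$ (for example the whole space, or a small ball around any point). An infinitesimal contact symmetry of the equation over $U$ is a smooth function $\varphi$ on $U$ (the characteristic, or generating function) such that the prolongation $$X_\varphi = \sum_{\alpha} D^\alpha(\varphi)\,\partial_{u_\alpha} - \varphi_{u_t} D_t - \varphi_{u_x} D_x - \varphi_{u_y} D_y$$ of its contact vector field satisfies $X_\varphi(F) = 0$ at all points over $U$ at which $F = 0$. Then $\varphi$ is an infinitesimal contact symmetry over $U$ if and only if there are real constants $c_1,\dots,c_5$ and smooth functions $A_1, A_2, A_3$ on the interval $\{t : (t,x,y,u,u_t,u_x,u_y)\in U\}$ such that on $U$ $$\varphi = c_1\varphi_1 + \dots + c_5\varphi_5 + \varphi_6(A_1) + \varphi_7(A_2)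 + \varphi_8(A_3),$$ where $$\varphi_1 = -t\,u_t - u,\quad \varphi_2 = -u_t,\quad \varphi_3 = -x\,u_x + y\,u_y,\quad \varphi_4 = -t\,x\,u_x + t\,y\,u_y + x\,y,\quad \varphi_5 = -x\,u_x - y\,u_y + 2u,$$ $$\varphi_6(A) = -A(t)\,u_x + A'(t)\,y,\qquad \varphi_7(A) = -A(t)\,u_y - A'(t)\,x,\qquad \varphi_8(A) = A(t).$$ These functions form a Lie algebra: they are closed under linear combinations and under the Jacobi bracket $\{\varphi,\psi\} = X_\varphi(\psi) - \varphi_u\,\psi$. -/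

import Mathlib

open scoped ContDiff

namespace EulerVorticity

/-- Coordinates on the infinite jet space of functions `u(t,x,y)`: the independent variables and
`u i j k`, which stands for the derivative of `u` taken `i` times in `t`, `j` times in `x` and
`k` times in `y`. -/
inductive JetCoord : Type
  | t | x | y
  | u (i j k : ℕ)
  deriving DecidableEq

/-- Points of the infinite jet space. -/
abbrev Jet : Type := JetCoord → ℝ

/-- Coordinates `t, x, y, u, u_t, u_x, u_y` on the space of first-order jets. -/
inductive J1Coord : Type
  | t | x | y | u | ut | ux | uy
  deriving DecidableEq

instance : Fintype J1Coord where
  elems := {.t, .x, .y, .u, .ut, .ux, .uy}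
  complete c := by cases c <;> decide

/-- Points of the space of first-order jets. -/
abbrev J1 : Type := J1Coord → ℝ

/-- A coordinate on first-order jets, as a coordinate on infinite jets. -/
def J1Coord.toJet : J1Coord → JetCoord
  | .t => .t
  | .x => .x
  | .y => .y
  | .u => .u 0 0 0
  | .ut => .u 1 0 0
  | .ux => .u 0 1 0
  | .uy => .u 0 0 1

/-- The projection of an infinite jet to its first-order part. -/
def proj1 (θ : Jet) : J1 := fun c => θ c.toJet

/-- The partial derivative of a function of the coordinates `ι` in the coordinate `c`. -/
noncomputable def pd {ι : Type} [DecidableEq ι] (c : ι) (f : (ι → ℝ) → ℝ) (p : ι → ℝ) : ℝ :=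
  deriv (fun s : ℝ => f (Function.update p c s)) (p c)

/-- Total derivative in `t` (for functions of finitely many jet coordinates). -/
noncomputable def Dt (f : Jet → ℝ) (θ : Jet) : ℝ :=
  pd .t f θ + ∑ᶠ α : ℕ × ℕ × ℕ,
    θ (.u (α.1 + 1) α.2.1 α.2.2) * pd (.u α.1 α.2.1 α.2.2) f θ

/-- Total derivative in `x`. -/
noncomputable def Dx (f : Jet → ℝ) (θ : Jet) : ℝ :=
  pd .x f θ + ∑ᶠ α : ℕ × ℕ × ℕ,
    θ (.u α.1 (α.2.1 + 1) α.2.2) * pd (.u α.1 α.2.1 α.2.2) f θ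

/-- Total derivative in `y`. -/
noncomputable def Dy (f : Jet → ℝ) (θ : Jet) : ℝ :=
  pd .y f θ + ∑ᶠ α : ℕ × ℕ × ℕ,
    θ (.u α.1 α.2.1 (α.2.2 + 1)) * pd (.u α.1 α.2.1 α.2.2) f θ

/-- The operator `D = D_x ∘ D_y`. -/
noncomputable def Dxy (f : Jet → ℝ) : Jet → ℝ := Dx (Dy f)

/-- `J(a, b) = a_x b_y - a_y b_x`. -/
noncomputable def Jac (a b : Jet → ℝ) (θ : Jet) : ℝ := Dx a θ * Dy b θ - Dy a θ * Dx b θ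

/-- The function `u` on the jet space. -/
def uFun (θ : Jet) : ℝ := θ (.u 0 0 0)

/-- `F = D(u_t) - J(u, D(u))`, the left-hand side of the equation `F = 0`. -/
noncomputable def F (θ : Jet) : ℝ := Dxy (Dt uFun) θ - Jac uFun (Dxy uFun) θ

/-- The prolonged contact vector field with characteristic `φ`, acting on functions on jets:
`X_φ = ∑_α D^α(φ) ∂/∂u_α - φ_{u_t} D_t - φ_{u_x} D_x - φ_{u_y} D_y`.
Applied to a function of order at most `k`, it is the `k`-th prolongation of the contact field
on first-order jets, and the result has order at most `k` again (for `k ≥ 1`). -/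
noncomputable def contactLift (φ : J1 → ℝ) (f : Jet → ℝ) (θ : Jet) : ℝ :=
  (∑ᶠ α : ℕ × ℕ × ℕ,
      (Dt^[α.1] (Dx^[α.2.1] (Dy^[α.2.2] (fun η => φ (proj1 η))))) θ
        * pd (.u α.1 α.2.1 α.2.2) f θ)
    - pd .ut φ (proj1 θ) * Dt f θ
    - pd .ux φ (proj1 θ) * Dx f θ
    - pd .uy φ (proj1 θ) * Dy f θ

/-- `φ` is (the characteristic of) an infinitesimal contact symmetry of the equation `F = 0` over
the set `U` of first-order jets: it is smooth on `U`, and its prolonged contact field is tangent to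
the submanifold `F = 0` of the jet space at all points over `U`. -/
def IsContactSymmetry (U : Set J1) (φ : J1 → ℝ) : Prop :=
  ContDiffOn ℝ ∞ φ U ∧
    ∀ θ : Jet, proj1 θ ∈ U → F θ = 0 → contactLift φ F θ = 0

/-- The Jacobi bracket of functions on first-order jets: `{φ, ψ} = X_φ(ψ) - φ_u ψ`, where
`X_φ = -∑ φ_{u_i} ∂_{x_i} + (φ - ∑ u_i φ_{u_i}) ∂_u + ∑ (φ_{x_i} + u_i φ_u) ∂_{u_i}` is the contact
field of `φ`; it is the bracket for which `[X_φ, X_ψ] = X_{{φ, ψ}}`. -/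
noncomputable def jacobiBracket (φ ψ : J1 → ℝ) (p : J1) : ℝ :=
  - pd .ut φ p * pd .t ψ p - pd .ux φ p * pd .x ψ p - pd .uy φ p * pd .y ψ p
    + (φ p - p .ut * pd .ut φ p - p .ux * pd .ux φ p - p .uy * pd .uy φ p) * pd .u ψ p
    + (pd .t φ p + p .ut * pd .u φ p) * pd .ut ψ p
    + (pd .x φ p + p .ux * pd .u φ p) * pd .ux ψ p
    + (pd .y φ p + p .uy * pd .u φ p) * pd .uy ψ p
    - pd .u φ p * ψ p

/-- `φ₁ = -t u_t - u`. -/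
def phi1 (p : J1) : ℝ := - p .t * p .ut - p .u

/-- `φ₂ = -u_t`. -/
def phi2 (p : J1) : ℝ := - p .ut

/-- `φ₃ = -x u_x + y u_y`. -/
def phi3 (p : J1) : ℝ := - p .x * p .ux + p .y * p .uy

/-- `φ₄ = -t x u_x + t y u_y + x y`. -/
def phi4 (p : J1) : ℝ := - p .t * p .x * p .ux + p .t * p .y * p .uy + p .x * p .y

/-- `φ₅ = -x u_x - y u_y + 2 u`. -/
def phi5 (p : J1) : ℝ := - p .x * p .ux - p .y * p .uy + 2 * p .u

/-- `φ₆(A) = -A(t) u_x + A'(t) y`. -/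
noncomputable def phi6 (A : ℝ → ℝ) (p : J1) : ℝ := - A (p .t) * p .ux + deriv A (p .t) * p .y

/-- `φ₇(A) = -A(t) u_y - A'(t) x`. -/
noncomputable def phi7 (A : ℝ → ℝ) (p : J1) : ℝ := - A (p .t) * p .uy - deriv A (p .t) * p .x

/-- `φ₈(A) = A(t)`. -/
def phi8 (A : ℝ → ℝ) (p : J1) : ℝ := A (p .t)

/-- The set of values of `t` on a set of first-order jets. -/
def times (U : Set J1) : Set ℝ := (fun p : J1 => p .t) '' U

end EulerVorticity

/-!
The characteristics are found by Lie's method. Applied to `F`, the prolonged contact field of `φ`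
gives an expression in which the fourth-order jet coordinates cancel (`contactLift_F_eq`); what
remains is affine in the third-order coordinates and polynomial in the second-order ones. On the
equation `F = 0`, which expresses `u_{txy}` by the other coordinates, all of these can be chosen
freely, so that the coefficients must vanish.

The coefficients of `u_{ttx}`, `u_{tty}`, `u_{txx}`, `u_{tyy}` give
`φ = a(t) u_t + b(t,x) u_x + c(t,y) u_y + d(t,x,y,u)` (`pd_pd_eq_zero_of_affineVary`), those of
`u_{tx}` and `u_{ty}` give `d = e(t) u + f(t,x,y)` (`pd_pd_u_eq_zero`), and those of `u_{xyy}`,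
`u_{xxy}`, `u_{xy}` and `1` complete the system `Determining`
(`IsContactSymmetry.determining`). These steps are carried out with the second and third
derivatives of `φ` instead of the functions `a`, ..., `f`: that a derivative vanishes is a local
statement, and symmetry of derivatives replaces the passage from one form to the next. Conversely
the system makes the whole expression a multiple of `F` (`Determining.isContactSymmetry`).

The system says that `φ_u` and `φ_{xy}` are constant, that `φ_{u_t}` is affine in `t`, and that
`φ_{u_x}` and `φ_{u_y}` are affine in `x` and `y`, respectively, with slopes affine in `t`. On a
convex set this integrates to the given generators
(`Determining.exists_eq_generalSolution`). The constants and functions of `t` in the bracket of two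
combinations of the generators can then be written down, and the claim is an identity of explicit
expressions.

Total derivatives are computed with `HasTotal`, which records partial derivatives along coordinate
lines of the infinite jet space together with the finiteness of their support. For a function of
first-order jets this gives closed formulas (`tot₁`, `tot₂`, `tot₃`) as sums over the seven
coordinates.
-/

namespace EulerVorticity

/-! ### Partial derivatives along coordinate lines -/

section PartialDerivatives
open Function

theorem differentiableAt_of_isOpen {E : Type*} [NormedAddCommGroup E] [NormedSpace ℝ E]
    {U : Set E} {f : E → ℝ} {p : E} (hU : IsOpen U) (hf : ContDiffOn ℝ ∞ f U) (hp : p ∈ U) :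
    DifferentiableAt ℝ f p :=
  (hf.contDiffAt (hU.mem_nhds hp)).differentiableAt (by simp)

variable {ι : Type} [DecidableEq ι] {f g : (ι → ℝ) → ℝ} {c : ι} {p : ι → ℝ} {a b : ℝ}

/-- `f` has the partial derivative `a` in the coordinate `c` at `p`. Only the restriction of `f`
to the coordinate line through `p` matters, so the notion makes sense on the infinite jet space. -/
def HasPd (f : (ι → ℝ) → ℝ) (c : ι) (p : ι → ℝ) (a : ℝ) : Prop :=
  HasDerivAt (fun s => f (update p c s)) a (p c)

theorem HasPd.pd_eq (h : HasPd f c p a) : pd c f p = a := h.deriv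

theorem hasPd_const (k : ℝ) : HasPd (fun _ : ι → ℝ => k) c p 0 := hasDerivAt_const _ _

theorem hasPd_coord (d : ι) : HasPd (fun q : ι → ℝ => q d) c p (if c = d then 1 else 0) := by
  unfold HasPd
  split_ifs with h
  · subst h
    simpa using hasDerivAt_id' (p c)
  · simpa [update_of_ne (Ne.symm h)] using hasDerivAt_const (p c) (p d)

theorem hasPd_comp_coord {A : ℝ → ℝ} {d : ι} (hA : DifferentiableAt ℝ A (p d)) :
    HasPd (fun q : ι → ℝ => A (q d)) c p (if c = d then deriv A (p d) else 0) := by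
  unfold HasPd
  split_ifs with h
  · subst h
    simpa using hA.hasDerivAt
  · simpa [update_of_ne (Ne.symm h)] using hasDerivAt_const (p c) (A (p d))

theorem HasPd.add (hf : HasPd f c p a) (hg : HasPd g c p b) :
    HasPd (fun q => f q + g q) c p (a + b) := HasDerivAt.fun_add hf hg

theorem HasPd.sub (hf : HasPd f c p a) (hg : HasPd g c p b) :
    HasPd (fun q => f q - g q) c p (a - b) := HasDerivAt.fun_sub hf hg

theorem HasPd.neg (hf : HasPd f c p a) : HasPd (fun q => - f q) c p (- a) := HasDerivAt.fun_neg hf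

theorem HasPd.mul (hf : HasPd f c p a) (hg : HasPd g c p b) :
    HasPd (fun q => f q * g q) c p (a * g p + f p * b) := by
  have := HasDerivAt.fun_mul hf hg
  simp only [update_eq_self] at this
  exact this

theorem HasPd.const_mul (k : ℝ) (hf : HasPd f c p a) : HasPd (fun q => k * f q) c p (k * a) :=
  HasDerivAt.const_mul k hf

theorem eventually_update_mem {V : Set (ι → ℝ)} (hV : IsOpen V) (hp : p ∈ V) :
    ∀ᶠ s in nhds (p c), update p c s ∈ V := by
  have hc : Continuous fun s : ℝ => update p c s := continuous_const.update c continuous_id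
  exact hc.continuousAt.eventually (by simpa using hV.mem_nhds hp)

theorem HasPd.congr {V : Set (ι → ℝ)} (hV : IsOpen V) (hp : p ∈ V) (hfg : ∀ q ∈ V, f q = g q)
    (hg : HasPd g c p a) : HasPd f c p a :=
  HasDerivAt.congr_of_eventuallyEq hg
    ((eventually_update_mem hV hp).mono fun _ hs => hfg _ hs)

theorem pd_congr {V : Set (ι → ℝ)} (hV : IsOpen V) (hp : p ∈ V) (hfg : ∀ q ∈ V, f q = g q) :
    pd c f p = pd c g p :=
  Filter.EventuallyEq.deriv_eq ((eventually_update_mem hV hp).mono fun _ hs => hfg _ hs)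

variable [Fintype ι] {U : Set (ι → ℝ)}

theorem hasPd_fderiv (h : DifferentiableAt ℝ f p) :
    HasPd f c p (fderiv ℝ f p (Pi.single c 1)) := by
  have h1 : HasFDerivAt f (fderiv ℝ f p) (update p c (p c)) := by
    simpa using h.hasFDerivAt
  exact h1.comp_hasDerivAt (p c) (hasDerivAt_update p c (p c))

theorem pd_eq_fderiv (hU : IsOpen U) (hf : ContDiffOn ℝ ∞ f U) (hp : p ∈ U) (c : ι) :
    pd c f p = fderiv ℝ f p (Pi.single c 1) :=
  (hasPd_fderiv (differentiableAt_of_isOpen hU hf hp)).pd_eq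

theorem hasPd_pd (hU : IsOpen U) (hf : ContDiffOn ℝ ∞ f U) (hp : p ∈ U) (c : ι) :
    HasPd f c p (pd c f p) := by
  rw [pd_eq_fderiv hU hf hp]
  exact hasPd_fderiv (differentiableAt_of_isOpen hU hf hp)

theorem contDiffOn_pd (hU : IsOpen U) (hf : ContDiffOn ℝ ∞ f U) (c : ι) :
    ContDiffOn ℝ ∞ (pd c f) U := by
  have h : ContDiffOn ℝ ∞ (fun q => fderiv ℝ f q (Pi.single c 1)) U :=
    (hf.fderiv_of_isOpen hU (by simp)).clm_apply contDiffOn_const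
  exact h.congr fun q hq => pd_eq_fderiv hU hf hq c

/-- Symmetry of second derivatives. -/
theorem pd_comm (hU : IsOpen U) (hf : ContDiffOn ℝ ∞ f U) (hp : p ∈ U) (c d : ι) :
    pd c (pd d f) p = pd d (pd c f) p := by
  have hdf : DifferentiableAt ℝ (fderiv ℝ f) p :=
    ((hf.fderiv_of_isOpen hU (m := ∞) (by simp)).contDiffAt (hU.mem_nhds hp)).differentiableAt
      (by simp)
  have key : ∀ c d : ι, pd c (pd d f) p
      = fderiv ℝ (fderiv ℝ f) p (Pi.single c 1) (Pi.single d 1) := by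
    intro c d
    rw [pd_congr hU hp fun q hq => pd_eq_fderiv hU hf hq d]
    have h2 : HasFDerivAt (fun q => fderiv ℝ f q (Pi.single d 1)) _ p :=
      hdf.hasFDerivAt.clm_apply (hasFDerivAt_const _ _)
    rw [(hasPd_fderiv h2.differentiableAt).pd_eq, h2.fderiv]
    simp
  have hs : IsSymmSndFDerivAt ℝ f p :=
    (hf.contDiffAt (hU.mem_nhds hp)).isSymmSndFDerivAt
      (by rw [minSmoothness_of_isRCLikeNormedField]; exact WithTop.coe_le_coe.2 le_top)
  rw [key, key, hs]

/-- On a convex open set, two points that differ only in coordinates in which `f` does not vary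
have the same value under `f`. -/
theorem eq_of_pd_eq_zero (hU : IsOpen U) (hconv : Convex ℝ U) (hf : ContDiffOn ℝ ∞ f U)
    {q : ι → ℝ} (hp : p ∈ U) (hq : q ∈ U)
    (h : ∀ c, p c = q c ∨ ∀ z ∈ U, pd c f z = 0) : f p = f q := by
  have hmem : ∀ s ∈ Set.Icc (0 : ℝ) 1, p + s • (q - p) ∈ U := fun s hs =>
    hconv.add_smul_sub_mem hp hq hs
  have hder : ∀ s ∈ Set.Icc (0 : ℝ) 1, HasDerivAt (fun s : ℝ => f (p + s • (q - p))) 0 s := by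
    intro s hs
    have h1 : HasDerivAt (fun s : ℝ => p + s • (q - p)) (q - p) s := by
      simpa using ((hasDerivAt_id s).smul_const (q - p)).const_add p
    have h2 := (differentiableAt_of_isOpen hU hf (hmem s hs)).hasFDerivAt.comp_hasDerivAt s h1
    suffices h0 : fderiv ℝ f (p + s • (q - p)) (q - p) = 0 by rwa [h0] at h2
    have hz := hmem s hs
    generalize p + s • (q - p) = z at hz ⊢
    rw [pi_eq_sum_univ' (q - p)]
    rw [map_sum]
    refine Finset.sum_eq_zero fun c _ => ?_
    rw [map_smul]
    rcases h c with h | h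
    · simp [h]
    · rw [← pd_eq_fderiv hU hf hz, h z hz, smul_zero]
  have := constant_of_has_deriv_right_zero (a := (0 : ℝ)) (b := 1)
    (f := fun s : ℝ => f (p + s • (q - p)))
    (fun s hs => (hder s hs).continuousAt.continuousWithinAt)
    (fun s hs => (hder s ⟨hs.1, hs.2.le⟩).hasDerivWithinAt) 1 (by simp)
  simpa using this.symm

theorem exists_eq_const (hU : IsOpen U) (hconv : Convex ℝ U) (hf : ContDiffOn ℝ ∞ f U)
    (h : ∀ c, ∀ z ∈ U, pd c f z = 0) : ∃ k, ∀ p ∈ U, f p = k := by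
  rcases U.eq_empty_or_nonempty with rfl | ⟨q, hq⟩
  · exact ⟨0, by simp⟩
  · exact ⟨f q, fun p hp => eq_of_pd_eq_zero hU hconv hf hp hq fun c => Or.inr (h c)⟩

end PartialDerivatives

/-! ### Functions of `t` -/

section Times

variable {U : Set J1}

theorem isOpen_times (hU : IsOpen U) : IsOpen (times U) := isOpenMap_eval _ U hU

theorem mem_times {p : J1} (hp : p ∈ U) : p .t ∈ times U := ⟨p, hp, rfl⟩

theorem differentiableAt_of_times (hU : IsOpen U) {A : ℝ → ℝ} (hA : ContDiffOn ℝ ∞ A (times U))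
    {p : J1} (hp : p ∈ U) : DifferentiableAt ℝ A (p .t) :=
  (hA.contDiffAt ((isOpen_times hU).mem_nhds (mem_times hp))).differentiableAt (by simp)

theorem contDiffOn_deriv_times (hU : IsOpen U) {A : ℝ → ℝ} (hA : ContDiffOn ℝ ∞ A (times U)) :
    ContDiffOn ℝ ∞ (deriv A) (times U) :=
  hA.deriv_of_isOpen (isOpen_times hU) (by simp)

theorem contDiffOn_comp_t {A : ℝ → ℝ} (hA : ContDiffOn ℝ ∞ A (times U)) :
    ContDiffOn ℝ ∞ (fun p : J1 => A (p .t)) U :=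
  hA.comp (contDiff_apply ℝ ℝ J1Coord.t).contDiffOn fun _ hp => mem_times hp

/-- A smooth function on a convex open set of first-order jets whose partial derivatives other than
the one in `t` vanish is a smooth function of `t`. -/
theorem exists_eq_comp_t (hU : IsOpen U) (hconv : Convex ℝ U) {f : J1 → ℝ}
    (hf : ContDiffOn ℝ ∞ f U) (h : ∀ c, c ≠ .t → ∀ z ∈ U, pd c f z = 0) :
    ∃ A : ℝ → ℝ, ContDiffOn ℝ ∞ A (times U) ∧ ∀ p ∈ U, f p = A (p .t) := by
  have hex : ∀ τ : ℝ, ∃ v : ℝ, ∀ p ∈ U, p .t = τ → f p = v := by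
    intro τ
    by_cases hτ : ∃ q ∈ U, q .t = τ
    · obtain ⟨q, hq, rfl⟩ := hτ
      refine ⟨f q, fun p hp hpq => eq_of_pd_eq_zero hU hconv hf hp hq fun c => ?_⟩
      by_cases hc : c = .t
      · left; rw [hc, hpq]
      · exact Or.inr (h c hc)
    · exact ⟨0, fun p hp hpt => absurd ⟨p, hp, hpt⟩ hτ⟩
  choose A hA using hex
  refine ⟨A, ?_, fun p hp => hA _ p hp rfl⟩
  rintro τ ⟨q, hq, rfl⟩
  -- near `q t`, the function `A` is the restriction of `f` to the `t`-line through `q`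
  have hline : ContDiff ℝ ∞ fun s : ℝ => Function.update q J1Coord.t s := contDiff_update _ q .t
  have hsm : ContDiffAt ℝ ∞ (fun s : ℝ => f (Function.update q J1Coord.t s)) (q .t) := by
    refine ContDiffAt.comp (q .t) ?_ hline.contDiffAt
    simpa using hf.contDiffAt (hU.mem_nhds hq)
  refine (hsm.congr_of_eventuallyEq ?_).contDiffWithinAt
  filter_upwards [eventually_update_mem (c := J1Coord.t) hU hq] with s hs
  exact (hA s _ hs (by simp)).symm

end Times

/-! ### Total derivatives on the jet space -/

section TotalDerivatives
open Function

/-- The independent variables, as directions of total differentiation. -/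
inductive Dir : Type
  | t | x | y

/-- The total derivative in a given direction. -/
noncomputable def tot : Dir → (Jet → ℝ) → Jet → ℝ
  | .t => Dt
  | .x => Dx
  | .y => Dy

/-- The jet coordinate of the derivative of `u_α` in a given direction; independent variables are
left alone. -/
def raise : Dir → JetCoord → JetCoord
  | .t, .u i j k => .u (i + 1) j k
  | .x, .u i j k => .u i (j + 1) k
  | .y, .u i j k => .u i j (k + 1)
  | _, c => c

/-- The total derivative of a jet coordinate. -/
def vel : Dir → JetCoord → Jet → ℝ
  | .t, .t, _ => 1
  | .x, .x, _ => 1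
  | .y, .y, _ => 1
  | i, .u a b c, θ => θ (raise i (.u a b c))
  | _, _, _ => 0

/-- The second total derivatives of a jet coordinate. -/
def vel₂ (j i : Dir) : JetCoord → Jet → ℝ
  | .u a b c, θ => θ (raise j (raise i (.u a b c)))
  | _, _ => 0

/-- The third total derivatives of a jet coordinate. -/
def vel₃ (k j i : Dir) : JetCoord → Jet → ℝ
  | .u a b c, θ => θ (raise k (raise j (raise i (.u a b c))))
  | _, _ => 0

/-- The total derivatives of `f` at the points of `V` are given by `g`, and at these points `f` has
all partial derivatives, only finitely many of them nonzero. The latter condition makes the sums in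
`Dt`, `Dx` and `Dy` finite. -/
def HasTotal (V : Set Jet) (f : Jet → ℝ) (g : Dir → Jet → ℝ) : Prop :=
  ∀ θ ∈ V, ∃ G : JetCoord →₀ ℝ, (∀ c, HasPd f c θ (G c)) ∧
    ∀ i, (G.sum fun c a => a * vel i c θ) = g i θ

/-- Pairing a finitely supported gradient `G` with the velocities in the direction `i`, whose own
coordinate is `b`, gives the expression that defines the total derivative. -/
theorem sum_mul_vel (G : JetCoord →₀ ℝ) (i : Dir) (b : JetCoord) (θ : Jet)
    (hb : vel i b θ = 1) (hbu : ∀ i j k, b ≠ .u i j k)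
    (h0 : ∀ c, c ≠ b → (∀ i j k, c ≠ .u i j k) → vel i c θ = 0) :
    (G.sum fun c a => a * vel i c θ)
      = G b + ∑ᶠ α : ℕ × ℕ × ℕ, vel i (.u α.1 α.2.1 α.2.2) θ * G (.u α.1 α.2.1 α.2.2) := by
  have hinj : Injective fun α : ℕ × ℕ × ℕ => JetCoord.u α.1 α.2.1 α.2.2 := by
    rintro ⟨a, b, c⟩ ⟨a', b', c'⟩ h
    simpa using h
  have hfin : ∀ G : JetCoord →₀ ℝ, (support fun α : ℕ × ℕ × ℕ =>
      vel i (.u α.1 α.2.1 α.2.2) θ * G (.u α.1 α.2.1 α.2.2)).Finite := by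
    intro G
    refine ((G.hasFiniteSupport).preimage hinj.injOn).subset fun α hα => ?_
    simp only [mem_support, ne_eq, mul_eq_zero, not_or] at hα
    exact hα.2
  induction G using Finsupp.induction_linear with
  | zero => simp
  | add G H hG hH =>
    rw [Finsupp.sum_add_index' (by simp) (by intros; ring), hG, hH]
    simp only [Finsupp.add_apply, mul_add]
    rw [finsum_add_distrib (hfin G) (hfin H)]
    ring
  | single c a =>
    rw [Finsupp.sum_single_index (by simp)]
    by_cases hc : ∃ i j k, c = .u i j k
    · obtain ⟨l, m, n, rfl⟩ := hc
      rw [Finsupp.single_eq_of_ne (hbu l m n),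
        finsum_eq_single _ (l, m, n)]
      · simp [mul_comm]
      · rintro ⟨l', m', n'⟩ h
        rw [Finsupp.single_eq_of_ne, mul_zero]
        simpa using h
    · push Not at hc
      have : ∀ α : ℕ × ℕ × ℕ, Finsupp.single c a (JetCoord.u α.1 α.2.1 α.2.2) = 0 := fun α =>
        Finsupp.single_eq_of_ne (hc _ _ _).symm
      simp only [this, mul_zero, finsum_zero, add_zero]
      by_cases hcb : c = b
      · subst hcb; simp [hb]
      · rw [h0 c hcb hc, Finsupp.single_eq_of_ne (Ne.symm hcb), mul_zero]

variable {V : Set Jet} {f f' : Jet → ℝ} {g g' : Dir → Jet → ℝ} {θ : Jet}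

theorem tot_eq_sum {G : JetCoord →₀ ℝ} (hG : ∀ c, HasPd f c θ (G c)) (i : Dir) :
    tot i f θ = G.sum fun c a => a * vel i c θ := by
  have hG' : ∀ c, pd c f θ = G c := fun c => (hG c).pd_eq
  cases i
  · rw [sum_mul_vel G .t .t θ rfl (by simp) (by rintro (_ | _ | _ | _) <;> simp [vel])]
    simp only [tot, Dt, hG']; rfl
  · rw [sum_mul_vel G .x .x θ rfl (by simp) (by rintro (_ | _ | _ | _) <;> simp [vel])]
    simp only [tot, Dx, hG']; rfl
  · rw [sum_mul_vel G .y .y θ rfl (by simp) (by rintro (_ | _ | _ | _) <;> simp [vel])]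
    simp only [tot, Dy, hG']; rfl

theorem HasTotal.tot_eq (h : HasTotal V f g) (hθ : θ ∈ V) (i : Dir) : tot i f θ = g i θ := by
  obtain ⟨G, hG, hg⟩ := h θ hθ
  rw [tot_eq_sum hG, hg]

theorem HasTotal.congr (hV : IsOpen V) (hff : ∀ θ ∈ V, f θ = f' θ) (h : HasTotal V f' g) :
    HasTotal V f g := fun θ hθ => by
  obtain ⟨G, hG, hg⟩ := h θ hθ
  exact ⟨G, fun c => (hG c).congr hV hθ hff, hg⟩

/-- A function whose total derivatives are known has a total derivative that can be
differentiated further. -/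
theorem HasTotal.tot (hV : IsOpen V) {i : Dir} {h : Dir → Jet → ℝ} (hf : HasTotal V f g)
    (hg : HasTotal V (g i) h) : HasTotal V (tot i f) h :=
  hg.congr hV fun _ hθ => hf.tot_eq hθ i

theorem hasTotal_const (k : ℝ) : HasTotal V (fun _ => k) fun _ _ => 0 := fun _ _ =>
  ⟨0, fun _ => hasPd_const k, by simp⟩

theorem hasTotal_coord (c : JetCoord) : HasTotal V (fun θ => θ c) fun i => vel i c := by
  refine fun θ _ => ⟨Finsupp.single c 1, fun d => ?_, fun i => by simp⟩
  have := hasPd_coord (c := d) (p := θ) c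
  simpa only [Finsupp.single_apply, eq_comm] using this

theorem HasTotal.add (h : HasTotal V f g) (h' : HasTotal V f' g') :
    HasTotal V (fun θ => f θ + f' θ) fun i θ => g i θ + g' i θ := by
  intro θ hθ
  obtain ⟨G, hG, hg⟩ := h θ hθ
  obtain ⟨G', hG', hg'⟩ := h' θ hθ
  refine ⟨G + G', fun c => (hG c).add (hG' c), fun i => ?_⟩
  rw [Finsupp.sum_add_index' (by simp) (by intros; ring), hg, hg']

theorem HasTotal.mul (h : HasTotal V f g) (h' : HasTotal V f' g') :
    HasTotal V (fun θ => f θ * f' θ) fun i θ => g i θ * f' θ + f θ * g' i θ := by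
  intro θ hθ
  obtain ⟨G, hG, hg⟩ := h θ hθ
  obtain ⟨G', hG', hg'⟩ := h' θ hθ
  refine ⟨f' θ • G + f θ • G', fun c => ?_, fun i => ?_⟩
  · convert (hG c).mul (hG' c) using 1
    simp [mul_comm]
  · beta_reduce
    rw [Finsupp.sum_add_index' (by simp) (by intros; ring),
      Finsupp.sum_smul_index (by simp), Finsupp.sum_smul_index (by simp), ← hg i, ← hg' i]
    simp only [Finsupp.sum, Finset.sum_mul, Finset.mul_sum]
    congr 1 <;> exact Finset.sum_congr rfl fun _ _ => by ring

theorem hasTotal_sum {κ : Type} (s : Finset κ) {f : κ → Jet → ℝ} {g : κ → Dir → Jet → ℝ}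
    (h : ∀ k ∈ s, HasTotal V (f k) (g k)) :
    HasTotal V (fun θ => ∑ k ∈ s, f k θ) fun i θ => ∑ k ∈ s, g k i θ := by
  classical
  induction s using Finset.induction_on with
  | empty => simpa using hasTotal_const 0
  | insert k s hk ih =>
    simp only [Finset.sum_insert hk]
    exact (h k (by simp)).add (ih fun l hl => h l (by simp [hl]))

theorem hasTotal_vel (i : Dir) (c : JetCoord) : HasTotal V (vel i c) fun j => vel₂ j i c := by
  rcases c with _ | _ | _ | ⟨a, b, c⟩
  case u =>
    have := hasTotal_coord (V := V) (raise i (.u a b c))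
    have e : (fun j => vel₂ j i (.u a b c)) = fun j => vel j (raise i (.u a b c)) := by
      funext j θ; cases i <;> cases j <;> rfl
    rw [e]
    cases i <;> exact this
  all_goals
    cases i
    all_goals first
      | exact hasTotal_const 1
      | exact hasTotal_const 0

theorem hasTotal_vel₂ (j i : Dir) (c : JetCoord) :
    HasTotal V (vel₂ j i c) fun k => vel₃ k j i c := by
  rcases c with _ | _ | _ | ⟨a, b, c⟩
  case u =>
    have := hasTotal_coord (V := V) (raise j (raise i (.u a b c)))
    have e : (fun k => vel₃ k j i (.u a b c))
        = fun k => vel k (raise j (raise i (.u a b c))) := by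
      funext k θ; cases i <;> cases j <;> cases k <;> rfl
    rw [e]
    exact this
  all_goals exact hasTotal_const 0

theorem continuous_proj1 : Continuous proj1 := continuous_pi fun c => continuous_apply c.toJet

theorem toJet_injective : Injective J1Coord.toJet := by
  intro c d h
  cases c <;> cases d <;> simp_all [J1Coord.toJet]

theorem proj1_update (c : J1Coord) (s : ℝ) :
    proj1 (update θ c.toJet s) = update (proj1 θ) c s := by
  ext d
  by_cases h : d = c
  · subst h; simp [proj1]
  · simp [proj1, h, toJet_injective.ne h]

theorem proj1_update_of_ne {d : JetCoord} (hd : ∀ c : J1Coord, c.toJet ≠ d) (s : ℝ) :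
    proj1 (update θ d s) = proj1 θ := by
  ext c
  simp [proj1, hd c]

variable {U : Set J1} {ψ : J1 → ℝ}

/-- The chain rule for a function of first-order jets. -/
theorem hasTotal_comp_proj1 (hU : IsOpen U) (hψ : ContDiffOn ℝ ∞ ψ U) :
    HasTotal (proj1 ⁻¹' U) (fun θ => ψ (proj1 θ))
      fun i θ => ∑ c : J1Coord, vel i c.toJet θ * pd c ψ (proj1 θ) := by
  classical
  intro θ hθ
  refine ⟨∑ c : J1Coord, Finsupp.single c.toJet (pd c ψ (proj1 θ)), fun d => ?_, fun i => ?_⟩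
  · rw [Finsupp.finsetSum_apply]
    by_cases hd : ∃ c : J1Coord, c.toJet = d
    · obtain ⟨c, rfl⟩ := hd
      rw [Finset.sum_eq_single c]
      · have := hasPd_pd hU hψ hθ c
        simp only [HasPd, proj1_update, Finsupp.single_eq_same]
        exact this
      · exact fun b _ hb => Finsupp.single_eq_of_ne (toJet_injective.ne hb).symm
      · simp
    · push Not at hd
      rw [Finset.sum_eq_zero fun c _ => Finsupp.single_eq_of_ne (hd c).symm]
      simp only [HasPd, proj1_update_of_ne hd]
      exact hasDerivAt_const _ _
  · rw [← Finsupp.sum_finsetSum_index (by simp) (by intros; ring)]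
    refine Finset.sum_congr rfl fun c _ => ?_
    rw [Finsupp.sum_single_index (by simp), mul_comm]

/-- The first total derivatives of a function `ψ` of first-order jets. -/
noncomputable def tot₁ (ψ : J1 → ℝ) (i : Dir) (θ : Jet) : ℝ :=
  ∑ c : J1Coord, vel i c.toJet θ * pd c ψ (proj1 θ)

/-- The second total derivatives of a function `ψ` of first-order jets. -/
noncomputable def tot₂ (ψ : J1 → ℝ) (j i : Dir) (θ : Jet) : ℝ :=
  ∑ c : J1Coord, (vel₂ j i c.toJet θ * pd c ψ (proj1 θ)
    + vel i c.toJet θ * tot₁ (pd c ψ) j θ)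

/-- The third total derivatives of a function `ψ` of first-order jets. -/
noncomputable def tot₃ (ψ : J1 → ℝ) (k j i : Dir) (θ : Jet) : ℝ :=
  ∑ c : J1Coord, (vel₃ k j i c.toJet θ * pd c ψ (proj1 θ)
    + vel₂ j i c.toJet θ * tot₁ (pd c ψ) k θ
    + (vel₂ k i c.toJet θ * tot₁ (pd c ψ) j θ + vel i c.toJet θ * tot₂ (pd c ψ) k j θ))

theorem hasTotal_tot₁ (hU : IsOpen U) (hψ : ContDiffOn ℝ ∞ ψ U) (i : Dir) :
    HasTotal (proj1 ⁻¹' U) (tot₁ ψ i) fun j => tot₂ ψ j i :=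
  hasTotal_sum _ fun c _ =>
    (hasTotal_vel i c.toJet).mul (hasTotal_comp_proj1 hU (contDiffOn_pd hU hψ c))

theorem hasTotal_tot₂ (hU : IsOpen U) (hψ : ContDiffOn ℝ ∞ ψ U) (j i : Dir) :
    HasTotal (proj1 ⁻¹' U) (tot₂ ψ j i) fun k => tot₃ ψ k j i :=
  hasTotal_sum _ fun c _ =>
    ((hasTotal_vel₂ j i c.toJet).mul (hasTotal_comp_proj1 hU (contDiffOn_pd hU hψ c))).add
      ((hasTotal_vel i c.toJet).mul (hasTotal_tot₁ hU (contDiffOn_pd hU hψ c) j))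

theorem tot_comp_proj1 (hU : IsOpen U) (hψ : ContDiffOn ℝ ∞ ψ U) (hθ : proj1 θ ∈ U) (i : Dir) :
    tot i (fun η => ψ (proj1 η)) θ = tot₁ ψ i θ :=
  (hasTotal_comp_proj1 hU hψ).tot_eq hθ i

theorem tot_tot_tot_comp_proj1 (hU : IsOpen U) (hψ : ContDiffOn ℝ ∞ ψ U) (hθ : proj1 θ ∈ U)
    (k j i : Dir) :
    tot k (tot j (tot i fun η => ψ (proj1 η))) θ = tot₃ ψ k j i θ := by
  have hV : IsOpen (proj1 ⁻¹' U) := hU.preimage continuous_proj1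
  have h1 : HasTotal (proj1 ⁻¹' U) (tot i fun η => ψ (proj1 η)) fun j => tot₂ ψ j i :=
    (hasTotal_comp_proj1 hU hψ).tot hV (hasTotal_tot₁ hU hψ i)
  exact (h1.tot hV (hasTotal_tot₂ hU hψ j i)).tot_eq hθ k

end TotalDerivatives

/-! ### The invariance condition -/

section ContactLift
open Function

variable {V : Set Jet} {U : Set J1} {φ : J1 → ℝ} {θ : Jet}

theorem tot_coord (i : Dir) (c : JetCoord) : tot i (fun θ => θ c) = vel i c :=
  funext fun _ => (hasTotal_coord c).tot_eq (Set.mem_univ _) i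

theorem F_eq (θ : Jet) :
    F θ = θ (.u 1 1 1) + (θ (.u 0 0 1) * θ (.u 0 2 1) + -1 * (θ (.u 0 1 0) * θ (.u 0 1 2))) := by
  have ht : ∀ c, Dt (fun θ => θ c) = vel .t c := tot_coord .t
  have hx : ∀ c, Dx (fun θ => θ c) = vel .x c := tot_coord .x
  have hy : ∀ c, Dy (fun θ => θ c) = vel .y c := tot_coord .y
  have hu : uFun = fun θ => θ (.u 0 0 0) := rfl
  have et : ∀ a b c, vel .t (.u a b c) = fun θ => θ (.u (a + 1) b c) := fun _ _ _ => rfl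
  have ex : ∀ a b c, vel .x (.u a b c) = fun θ => θ (.u a (b + 1) c) := fun _ _ _ => rfl
  have ey : ∀ a b c, vel .y (.u a b c) = fun θ => θ (.u a b (c + 1)) := fun _ _ _ => rfl
  simp only [F, Jac, Dxy, hu, ht, hx, hy, et, ex, ey]
  norm_num
  ring

theorem hasPd_F (c : JetCoord) : HasPd F c θ
    ((if c = .u 1 1 1 then 1 else 0)
      + (((if c = .u 0 0 1 then 1 else 0) * θ (.u 0 2 1)
          + θ (.u 0 0 1) * (if c = .u 0 2 1 then 1 else 0))
        + -1 * ((if c = .u 0 1 0 then 1 else 0) * θ (.u 0 1 2)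
          + θ (.u 0 1 0) * (if c = .u 0 1 2 then 1 else 0)))) := by
  rw [funext F_eq]
  exact (hasPd_coord _).add (((hasPd_coord _).mul (hasPd_coord _)).add
    (((hasPd_coord _).mul (hasPd_coord _)).const_mul _))

theorem tot_F (i : Dir) : tot i F θ = vel i (.u 1 1 1) θ
      + ((vel i (.u 0 0 1) θ * θ (.u 0 2 1) + θ (.u 0 0 1) * vel i (.u 0 2 1) θ)
        - (vel i (.u 0 1 0) θ * θ (.u 0 1 2) + θ (.u 0 1 0) * vel i (.u 0 1 2) θ)) := by
  rw [funext F_eq]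
  have h := ((hasTotal_coord (V := Set.univ) (.u 1 1 1)).add
    (((hasTotal_coord (.u 0 0 1)).mul (hasTotal_coord (.u 0 2 1))).add
    ((hasTotal_const (-1)).mul
      ((hasTotal_coord (.u 0 1 0)).mul (hasTotal_coord (.u 0 1 2)))))).tot_eq (Set.mem_univ θ) i
  rw [h]
  ring

/-- The fourth-order form of the invariance condition: the coefficients of `X_φ` on the five
coordinates in `F` are total derivatives of `φ`. -/
theorem contactLift_F (hU : IsOpen U) (hφ : ContDiffOn ℝ ∞ φ U) (hθ : proj1 θ ∈ U) :
    contactLift φ F θ = tot₃ φ .t .x .y θ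
      - (θ (.u 0 1 0) * tot₃ φ .x .y .y θ + θ (.u 0 1 2) * tot₁ φ .x θ)
      + (θ (.u 0 0 1) * tot₃ φ .x .x .y θ + θ (.u 0 2 1) * tot₁ φ .y θ)
      - pd .ut φ (proj1 θ) * tot .t F θ
      - pd .ux φ (proj1 θ) * tot .x F θ
      - pd .uy φ (proj1 θ) * tot .y F θ := by
  have h1 := tot_comp_proj1 hU hφ hθ
  have h3 := tot_tot_tot_comp_proj1 hU hφ hθ
  have hx := h1 .x
  have hy := h1 .y
  have htxy := h3 .t .x .y
  have hxyy := h3 .x .y .y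
  have hxxy := h3 .x .x .y
  simp only [tot] at hx hy htxy hxyy hxxy
  simp only [contactLift, tot, (hasPd_F _).pd_eq]
  rw [finsum_eq_sum_of_support_subset
    (s := {(1, 1, 1), (0, 1, 0), (0, 1, 2), (0, 0, 1), (0, 2, 1)})]
  · simp [hx, hy, htxy, hxyy, hxxy]
    ring
  · rintro ⟨i, j, k⟩ h
    contrapose! h
    simp only [Finset.coe_insert, Finset.coe_singleton, Set.mem_insert_iff,
      Set.mem_singleton_iff, Prod.mk.injEq, not_or] at h
    obtain ⟨h1, h2, h3, h4, h5⟩ := h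
    simp [h1, h2, h3, h4, h5]

theorem sum_J1Coord (f : J1Coord → ℝ) :
    ∑ c, f c = f .t + f .x + f .y + f .u + f .ut + f .ux + f .uy := by
  have h : (Finset.univ : Finset J1Coord) = {.t, .x, .y, .u, .ut, .ux, .uy} := rfl
  rw [h]
  simp
  ring

theorem sum_vel_t (f : J1Coord → ℝ) : ∑ c, vel .t c.toJet θ * f c
    = f .t + θ (.u 1 0 0) * f .u + θ (.u 2 0 0) * f .ut + θ (.u 1 1 0) * f .ux
      + θ (.u 1 0 1) * f .uy := by
  simp [sum_J1Coord, vel, J1Coord.toJet, raise]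

theorem sum_vel_x (f : J1Coord → ℝ) : ∑ c, vel .x c.toJet θ * f c
    = f .x + θ (.u 0 1 0) * f .u + θ (.u 1 1 0) * f .ut + θ (.u 0 2 0) * f .ux
      + θ (.u 0 1 1) * f .uy := by
  simp [sum_J1Coord, vel, J1Coord.toJet, raise]

theorem sum_vel_y (f : J1Coord → ℝ) : ∑ c, vel .y c.toJet θ * f c
    = f .y + θ (.u 0 0 1) * f .u + θ (.u 1 0 1) * f .ut + θ (.u 0 1 1) * f .ux
      + θ (.u 0 0 2) * f .uy := by
  simp [sum_J1Coord, vel, J1Coord.toJet, raise]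

theorem sum_vel₂ (j i : Dir) (f : J1Coord → ℝ) : ∑ c, vel₂ j i c.toJet θ * f c
    = θ (raise j (raise i (.u 0 0 0))) * f .u + θ (raise j (raise i (.u 1 0 0))) * f .ut
      + θ (raise j (raise i (.u 0 1 0))) * f .ux + θ (raise j (raise i (.u 0 0 1))) * f .uy := by
  simp [sum_J1Coord, vel₂, J1Coord.toJet]

theorem sum_vel₃ (k j i : Dir) (f : J1Coord → ℝ) : ∑ c, vel₃ k j i c.toJet θ * f c
    = θ (raise k (raise j (raise i (.u 0 0 0)))) * f .u
      + θ (raise k (raise j (raise i (.u 1 0 0)))) * f .ut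
      + θ (raise k (raise j (raise i (.u 0 1 0)))) * f .ux
      + θ (raise k (raise j (raise i (.u 0 0 1)))) * f .uy := by
  simp [sum_J1Coord, vel₃, J1Coord.toJet]

/-- The terms of a third total derivative of `φ` that contain third derivatives of `φ`; they
involve jet coordinates of order at most two. -/
noncomputable def cubic (φ : J1 → ℝ) (k j i : Dir) (θ : Jet) : ℝ :=
  ∑ c : J1Coord, vel i c.toJet θ * ∑ d : J1Coord, vel j d.toJet θ * tot₁ (pd d (pd c φ)) k θ

/-- The third total derivative, sorted by the order of the derivatives of `φ`. The symmetry of the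
second derivatives of `φ` makes the three middle terms permutations of each other. -/
theorem tot₃_eq (hU : IsOpen U) (hφ : ContDiffOn ℝ ∞ φ U) (hθ : proj1 θ ∈ U) (k j i : Dir) :
    tot₃ φ k j i θ = ∑ c : J1Coord, vel₃ k j i c.toJet θ * pd c φ (proj1 θ)
      + ∑ c : J1Coord, vel₂ j i c.toJet θ * tot₁ (pd c φ) k θ
      + ∑ c : J1Coord, vel₂ k i c.toJet θ * tot₁ (pd c φ) j θ
      + ∑ c : J1Coord, vel₂ k j c.toJet θ * tot₁ (pd c φ) i θ
      + cubic φ k j i θ := by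
  have h : ∑ c : J1Coord, vel₂ k j c.toJet θ * tot₁ (pd c φ) i θ
      = ∑ c : J1Coord, vel i c.toJet θ *
        ∑ d : J1Coord, vel₂ k j d.toJet θ * pd d (pd c φ) (proj1 θ) := by
    simp only [tot₁, Finset.mul_sum]
    rw [Finset.sum_comm]
    refine Finset.sum_congr rfl fun c _ => Finset.sum_congr rfl fun d _ => ?_
    rw [pd_comm hU hφ hθ c d]
    ring
  rw [h]
  simp only [tot₃, cubic, tot₂, Finset.sum_add_distrib, mul_add]
  ring

/-- The result of applying the prolonged contact field of `φ` to `F`. The fourth-order jet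
coordinates cancel; in the third-order ones the expression is affine. -/
theorem contactLift_F_eq (hU : IsOpen U) (hφ : ContDiffOn ℝ ∞ φ U) (hθ : proj1 θ ∈ U) :
    contactLift φ F θ =
      cubic φ .t .x .y θ - θ (.u 0 1 0) * cubic φ .x .y .y θ + θ (.u 0 0 1) * cubic φ .x .x .y θ
      + θ (.u 1 1 1) * pd .u φ (proj1 θ)
      + (θ (.u 0 1 1) * tot₁ (pd .u φ) .t θ + θ (.u 1 1 1) * tot₁ (pd .ut φ) .t θ
        + θ (.u 0 2 1) * tot₁ (pd .ux φ) .t θ + θ (.u 0 1 2) * tot₁ (pd .uy φ) .t θ)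
      + (θ (.u 1 0 1) * tot₁ (pd .u φ) .x θ + θ (.u 2 0 1) * tot₁ (pd .ut φ) .x θ
        + θ (.u 1 1 1) * tot₁ (pd .ux φ) .x θ + θ (.u 1 0 2) * tot₁ (pd .uy φ) .x θ)
      + (θ (.u 1 1 0) * tot₁ (pd .u φ) .y θ + θ (.u 2 1 0) * tot₁ (pd .ut φ) .y θ
        + θ (.u 1 2 0) * tot₁ (pd .ux φ) .y θ + θ (.u 1 1 1) * tot₁ (pd .uy φ) .y θ)
      - θ (.u 0 1 0) * (θ (.u 0 1 2) * pd .u φ (proj1 θ)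
        + (θ (.u 0 0 2) * tot₁ (pd .u φ) .x θ + θ (.u 1 0 2) * tot₁ (pd .ut φ) .x θ
          + θ (.u 0 1 2) * tot₁ (pd .ux φ) .x θ + θ (.u 0 0 3) * tot₁ (pd .uy φ) .x θ)
        + 2 * (θ (.u 0 1 1) * tot₁ (pd .u φ) .y θ + θ (.u 1 1 1) * tot₁ (pd .ut φ) .y θ
          + θ (.u 0 2 1) * tot₁ (pd .ux φ) .y θ + θ (.u 0 1 2) * tot₁ (pd .uy φ) .y θ))
      + θ (.u 0 0 1) * (θ (.u 0 2 1) * pd .u φ (proj1 θ)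
        + 2 * (θ (.u 0 1 1) * tot₁ (pd .u φ) .x θ + θ (.u 1 1 1) * tot₁ (pd .ut φ) .x θ
          + θ (.u 0 2 1) * tot₁ (pd .ux φ) .x θ + θ (.u 0 1 2) * tot₁ (pd .uy φ) .x θ)
        + (θ (.u 0 2 0) * tot₁ (pd .u φ) .y θ + θ (.u 1 2 0) * tot₁ (pd .ut φ) .y θ
          + θ (.u 0 3 0) * tot₁ (pd .ux φ) .y θ + θ (.u 0 2 1) * tot₁ (pd .uy φ) .y θ))
      - θ (.u 0 1 2) * (pd .x φ (proj1 θ) + θ (.u 0 1 0) * pd .u φ (proj1 θ))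
      + θ (.u 0 2 1) * (pd .y φ (proj1 θ) + θ (.u 0 0 1) * pd .u φ (proj1 θ)) := by
  have hx : tot₁ φ .x θ = _ := sum_vel_x fun c => pd c φ (proj1 θ)
  have hy : tot₁ φ .y θ = _ := sum_vel_y fun c => pd c φ (proj1 θ)
  rw [contactLift_F hU hφ hθ, tot₃_eq hU hφ hθ, tot₃_eq hU hφ hθ, tot₃_eq hU hφ hθ, hx, hy]
  simp only [sum_vel₂, sum_vel₃, tot_F, vel, raise, zero_add, Nat.reduceAdd]
  ring

end ContactLift

/-! ### The determining equations -/

section DeterminingEquations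

variable {U : Set J1} {φ ψ : J1 → ℝ} {p : J1}

/-- The jet over the first-order jet `p` with second-order coordinates `q`, third-order coordinates
`r`, and vanishing coordinates of higher order. -/
def mkJet (p : J1) (q r : ℕ → ℕ → ℕ → ℝ) : Jet
  | .t => p .t
  | .x => p .x
  | .y => p .y
  | .u 0 0 0 => p .u
  | .u 1 0 0 => p .ut
  | .u 0 1 0 => p .ux
  | .u 0 0 1 => p .uy
  | .u i j k => match i + j + k with
    | 2 => q i j k
    | 3 => r i j k
    | _ => 0

/-- The family of numbers indexed by multi-indices with a single entry `1`. -/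
def unitIndex (a b c : ℕ) (i j k : ℕ) : ℝ := if i = a ∧ j = b ∧ k = c then 1 else 0

theorem proj1_mkJet (p : J1) (q r : ℕ → ℕ → ℕ → ℝ) : proj1 (mkJet p q r) = p := by
  ext c; cases c <;> rfl

theorem tot₁_mkJet (ψ : J1 → ℝ) (i : Dir) (p : J1) (q r : ℕ → ℕ → ℕ → ℝ) :
    tot₁ ψ i (mkJet p q r) = tot₁ ψ i (mkJet p q 0) := by
  cases i <;> simp only [tot₁, sum_vel_t, sum_vel_x, sum_vel_y, proj1_mkJet] <;> rfl

theorem cubic_mkJet (φ : J1 → ℝ) (k j i : Dir) (p : J1) (q r : ℕ → ℕ → ℕ → ℝ) :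
    cubic φ k j i (mkJet p q r) = cubic φ k j i (mkJet p q 0) := by
  unfold cubic
  simp only [tot₁_mkJet _ _ _ _ r]
  cases i <;> cases j <;> simp only [sum_vel_t, sum_vel_x, sum_vel_y] <;> rfl

theorem tot₁_mkJet_t (ψ : J1 → ℝ) (p : J1) (q r : ℕ → ℕ → ℕ → ℝ) :
    tot₁ ψ .t (mkJet p q r) = pd .t ψ p + p .ut * pd .u ψ p + q 2 0 0 * pd .ut ψ p
      + q 1 1 0 * pd .ux ψ p + q 1 0 1 * pd .uy ψ p := by
  simp only [tot₁, sum_vel_t, proj1_mkJet]; rfl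

theorem tot₁_mkJet_x (ψ : J1 → ℝ) (p : J1) (q r : ℕ → ℕ → ℕ → ℝ) :
    tot₁ ψ .x (mkJet p q r) = pd .x ψ p + p .ux * pd .u ψ p + q 1 1 0 * pd .ut ψ p
      + q 0 2 0 * pd .ux ψ p + q 0 1 1 * pd .uy ψ p := by
  simp only [tot₁, sum_vel_x, proj1_mkJet]; rfl

theorem tot₁_mkJet_y (ψ : J1 → ℝ) (p : J1) (q r : ℕ → ℕ → ℕ → ℝ) :
    tot₁ ψ .y (mkJet p q r) = pd .y ψ p + p .uy * pd .u ψ p + q 1 0 1 * pd .ut ψ p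
      + q 0 1 1 * pd .ux ψ p + q 0 0 2 * pd .uy ψ p := by
  simp only [tot₁, sum_vel_y, proj1_mkJet]; rfl

/-- The invariance condition at the jet with coordinates `p`, `q`, `r`; the equation `F = 0`
determines `u_{txy}` by the other coordinates. -/
theorem invariance_mkJet (hU : IsOpen U) (h : IsContactSymmetry U φ) (hp : p ∈ U)
    (q r : ℕ → ℕ → ℕ → ℝ) (hr : r 1 1 1 = p .ux * r 0 1 2 - p .uy * r 0 2 1) :
      cubic φ .t .x .y (mkJet p q 0) - p .ux * cubic φ .x .y .y (mkJet p q 0)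
      + p .uy * cubic φ .x .x .y (mkJet p q 0)
      + r 1 1 1 * pd .u φ p
      + (q 0 1 1 * tot₁ (pd .u φ) .t (mkJet p q 0) + r 1 1 1 * tot₁ (pd .ut φ) .t (mkJet p q 0)
        + r 0 2 1 * tot₁ (pd .ux φ) .t (mkJet p q 0) + r 0 1 2 * tot₁ (pd .uy φ) .t (mkJet p q 0))
      + (q 1 0 1 * tot₁ (pd .u φ) .x (mkJet p q 0) + r 2 0 1 * tot₁ (pd .ut φ) .x (mkJet p q 0)
        + r 1 1 1 * tot₁ (pd .ux φ) .x (mkJet p q 0) + r 1 0 2 * tot₁ (pd .uy φ) .x (mkJet p q 0))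
      + (q 1 1 0 * tot₁ (pd .u φ) .y (mkJet p q 0) + r 2 1 0 * tot₁ (pd .ut φ) .y (mkJet p q 0)
        + r 1 2 0 * tot₁ (pd .ux φ) .y (mkJet p q 0) + r 1 1 1 * tot₁ (pd .uy φ) .y (mkJet p q 0))
      - p .ux * (r 0 1 2 * pd .u φ p
        + (q 0 0 2 * tot₁ (pd .u φ) .x (mkJet p q 0) + r 1 0 2 * tot₁ (pd .ut φ) .x (mkJet p q 0)
          + r 0 1 2 * tot₁ (pd .ux φ) .x (mkJet p q 0)
          + r 0 0 3 * tot₁ (pd .uy φ) .x (mkJet p q 0))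
        + 2 * (q 0 1 1 * tot₁ (pd .u φ) .y (mkJet p q 0)
          + r 1 1 1 * tot₁ (pd .ut φ) .y (mkJet p q 0)
          + r 0 2 1 * tot₁ (pd .ux φ) .y (mkJet p q 0)
          + r 0 1 2 * tot₁ (pd .uy φ) .y (mkJet p q 0)))
      + p .uy * (r 0 2 1 * pd .u φ p
        + 2 * (q 0 1 1 * tot₁ (pd .u φ) .x (mkJet p q 0)
          + r 1 1 1 * tot₁ (pd .ut φ) .x (mkJet p q 0)
          + r 0 2 1 * tot₁ (pd .ux φ) .x (mkJet p q 0)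
          + r 0 1 2 * tot₁ (pd .uy φ) .x (mkJet p q 0))
        + (q 0 2 0 * tot₁ (pd .u φ) .y (mkJet p q 0) + r 1 2 0 * tot₁ (pd .ut φ) .y (mkJet p q 0)
          + r 0 3 0 * tot₁ (pd .ux φ) .y (mkJet p q 0)
          + r 0 2 1 * tot₁ (pd .uy φ) .y (mkJet p q 0)))
      - r 0 1 2 * (pd .x φ p + p .ux * pd .u φ p)
      + r 0 2 1 * (pd .y φ p + p .uy * pd .u φ p) = 0 := by
  have hF : F (mkJet p q r) = 0 := by
    rw [F_eq]
    change r 1 1 1 + (p .uy * r 0 2 1 + -1 * (p .ux * r 0 1 2)) = 0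
    rw [hr]; ring
  have h1 := h.2 (mkJet p q r) (by rwa [proj1_mkJet]) hF
  rw [contactLift_F_eq hU h.1 (by rwa [proj1_mkJet])] at h1
  simp only [tot₁_mkJet _ _ _ _ r, cubic_mkJet _ _ _ _ _ _ r, proj1_mkJet] at h1
  exact h1

/-- The coefficients of the third-order coordinates in the invariance condition. -/
theorem thirdOrder_coeffs (hU : IsOpen U) (h : IsContactSymmetry U φ) (hp : p ∈ U)
    (q : ℕ → ℕ → ℕ → ℝ) :
    tot₁ (pd .ut φ) .y (mkJet p q 0) = 0 ∧ tot₁ (pd .ut φ) .x (mkJet p q 0) = 0 ∧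
    tot₁ (pd .ux φ) .y (mkJet p q 0) = 0 ∧ tot₁ (pd .uy φ) .x (mkJet p q 0) = 0 ∧
    tot₁ (pd .uy φ) .t (mkJet p q 0) - pd .x φ p - p .ux * pd .u φ p
      + p .ux * (tot₁ (pd .ut φ) .t (mkJet p q 0) - tot₁ (pd .uy φ) .y (mkJet p q 0)) = 0 ∧
    tot₁ (pd .ux φ) .t (mkJet p q 0) + pd .y φ p + p .uy * pd .u φ p
      + p .uy * (tot₁ (pd .ux φ) .x (mkJet p q 0) - tot₁ (pd .ut φ) .t (mkJet p q 0)) = 0 := by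
  have h0 := invariance_mkJet hU h hp q 0 (by simp)
  have h1 := invariance_mkJet hU h hp q (unitIndex 2 1 0) (by simp [unitIndex])
  have h2 := invariance_mkJet hU h hp q (unitIndex 2 0 1) (by simp [unitIndex])
  have h3 := invariance_mkJet hU h hp q (unitIndex 1 2 0) (by simp [unitIndex])
  have h4 := invariance_mkJet hU h hp q (unitIndex 1 0 2) (by simp [unitIndex])
  have h5 := invariance_mkJet hU h hp q
    (fun i j k => unitIndex 0 1 2 i j k + p .ux * unitIndex 1 1 1 i j k) (by simp [unitIndex])
  have h6 := invariance_mkJet hU h hp q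
    (fun i j k => unitIndex 0 2 1 i j k - p .uy * unitIndex 1 1 1 i j k) (by simp [unitIndex])
  simp [unitIndex] at h0 h1 h2 h3 h4 h5 h6
  have e1 : tot₁ (pd .ut φ) .y (mkJet p q 0) = 0 := by linear_combination h1 - h0
  have e2 : tot₁ (pd .ut φ) .x (mkJet p q 0) = 0 := by linear_combination h2 - h0
  have e3 : tot₁ (pd .ux φ) .y (mkJet p q 0) = 0 := by
    linear_combination h3 - h0 - p .uy * e1
  have e4 : tot₁ (pd .uy φ) .x (mkJet p q 0) = 0 := by
    linear_combination h4 - h0 + p .ux * e2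
  simp only [e1, e2, e3, e4] at h5 h6
  exact ⟨e1, e2, e3, e4, by linear_combination h5 - h0, by linear_combination h6 - h0⟩

/-- A function `ψ` without dependence on the coordinate `l` for which
`∂_i ψ + l ∂_u ψ` vanishes depends neither on the coordinate `i` nor on `u`. -/
theorem pd_u_eq_zero_and (hU : IsOpen U) (hψ : ContDiffOn ℝ ∞ ψ U) {i l : J1Coord}
    (h0 : ∀ p ∈ U, pd l ψ p = 0) (h : ∀ p ∈ U, pd i ψ p + p l * pd .u ψ p = 0) :
    (∀ p ∈ U, pd i ψ p = 0) ∧ ∀ p ∈ U, pd .u ψ p = 0 := by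
  have hu : ∀ p ∈ U, pd .u ψ p = 0 := by
    intro p hp
    have hl : ∀ c, pd l (pd c ψ) p = 0 := fun c => by
      rw [pd_comm hU hψ hp, pd_congr (g := fun _ => 0) hU hp h0, (hasPd_const 0).pd_eq]
    have h1 := (hasPd_pd hU (contDiffOn_pd hU hψ i) hp l).add
      ((hasPd_coord l).mul (hasPd_pd hU (contDiffOn_pd hU hψ .u) hp l))
    have h2 : HasPd (fun q => pd i ψ q + q l * pd .u ψ q) l p 0 :=
      (hasPd_const 0).congr hU hp h
    simpa [hl] using h1.pd_eq.symm.trans h2.pd_eq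
  refine ⟨fun p hp => ?_, hu⟩
  simpa [hu p hp] using h p hp

/-- The pairs of coordinates for which the mixed second derivatives of a characteristic do not have
to vanish. -/
def mayVary : J1Coord → J1Coord → Bool
  | .t, c => c ≠ .u
  | .x, c => c = .t || c = .y || c = .ux
  | .y, c => c = .t || c = .x || c = .uy
  | .u, _ => false
  | .ut, c => c = .t
  | .ux, c => c = .t || c = .x
  | .uy, c => c = .t || c = .y

theorem pd_eq_zero_of_eq_zero (hU : IsOpen U) (h : ∀ p ∈ U, ψ p = 0) (c : J1Coord) (hp : p ∈ U) :
    pd c ψ p = 0 := by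
  rw [pd_congr (g := fun _ => 0) hU hp h, (hasPd_const 0).pd_eq]

/-- Third derivatives vanish if a second derivative in two of the three coordinates does. -/
theorem pd_pd_pd_eq_zero (hU : IsOpen U) (hφ : ContDiffOn ℝ ∞ φ U) {Z : J1Coord → J1Coord → Bool}
    (hZ : ∀ c d, Z c d = false → ∀ p ∈ U, pd c (pd d φ) p = 0) (hp : p ∈ U) (e d c : J1Coord)
    (h : (Z e d && Z d c && Z e c) = false) : pd e (pd d (pd c φ)) p = 0 := by
  simp only [Bool.and_eq_false_iff] at h
  rcases h with (h | h) | h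
  · rw [pd_congr hU hp fun q hq => pd_comm hU hφ hq d c, pd_comm hU (contDiffOn_pd hU hφ d) hp]
    exact pd_eq_zero_of_eq_zero hU (hZ e d h) c hp
  · exact pd_eq_zero_of_eq_zero hU (hZ d c h) e hp
  · rw [pd_comm hU (contDiffOn_pd hU hφ c) hp]
    exact pd_eq_zero_of_eq_zero hU (hZ e c h) d hp

/-- The determining equations of the contact symmetries: a linear system for `φ` that is equivalent
to the invariance of `F = 0`, solved for some of the second derivatives of `φ`. -/
structure Determining (U : Set J1) (φ : J1 → ℝ) : Prop where
  zero : ∀ c d, mayVary c d = false → ∀ p ∈ U, pd c (pd d φ) p = 0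
  t_ut : ∀ p ∈ U, pd .t (pd .ut φ) p = pd .u φ p + pd .x (pd .ux φ) p + pd .y (pd .uy φ) p
  t_uy : ∀ p ∈ U, pd .t (pd .uy φ) p = pd .x φ p - p .ux * pd .x (pd .ux φ) p
  t_ux : ∀ p ∈ U, pd .t (pd .ux φ) p = - pd .y φ p + p .uy * pd .y (pd .uy φ) p
  txy : ∀ p ∈ U, pd .t (pd .x (pd .y φ)) p = 0

end DeterminingEquations

/-! ### Contact symmetries satisfy the determining equations -/

section Necessity

variable {U : Set J1} {φ ψ : J1 → ℝ} {p : J1}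

theorem pd_eq_zero_of_tot₁_x (hU : IsOpen U) (hψ : ContDiffOn ℝ ∞ ψ U)
    (h : ∀ p ∈ U, ∀ q, tot₁ ψ .x (mkJet p q 0) = 0) (c : J1Coord) (hct : c ≠ .t) (hcy : c ≠ .y) :
    ∀ p ∈ U, pd c ψ p = 0 := by
  simp only [tot₁_mkJet_x] at h
  have h0 : ∀ p ∈ U, pd .x ψ p + p .ux * pd .u ψ p = 0 := fun p hp => by simpa using h p hp 0
  have h1 : ∀ p ∈ U, pd .ut ψ p = 0 := fun p hp => by
    simpa [unitIndex, h0 p hp] using h p hp (unitIndex 1 1 0)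
  have h2 : ∀ p ∈ U, pd .ux ψ p = 0 := fun p hp => by
    simpa [unitIndex, h0 p hp] using h p hp (unitIndex 0 2 0)
  have h3 : ∀ p ∈ U, pd .uy ψ p = 0 := fun p hp => by
    simpa [unitIndex, h0 p hp] using h p hp (unitIndex 0 1 1)
  have h4 := pd_u_eq_zero_and hU hψ h2 h0
  cases c
  exacts [absurd rfl hct, h4.1, absurd rfl hcy, h4.2, h1, h2, h3]

theorem pd_eq_zero_of_tot₁_y (hU : IsOpen U) (hψ : ContDiffOn ℝ ∞ ψ U)
    (h : ∀ p ∈ U, ∀ q, tot₁ ψ .y (mkJet p q 0) = 0) (c : J1Coord) (hct : c ≠ .t) (hcx : c ≠ .x) :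
    ∀ p ∈ U, pd c ψ p = 0 := by
  simp only [tot₁_mkJet_y] at h
  have h0 : ∀ p ∈ U, pd .y ψ p + p .uy * pd .u ψ p = 0 := fun p hp => by simpa using h p hp 0
  have h1 : ∀ p ∈ U, pd .ut ψ p = 0 := fun p hp => by
    simpa [unitIndex, h0 p hp] using h p hp (unitIndex 1 0 1)
  have h2 : ∀ p ∈ U, pd .ux ψ p = 0 := fun p hp => by
    simpa [unitIndex, h0 p hp] using h p hp (unitIndex 0 1 1)
  have h3 : ∀ p ∈ U, pd .uy ψ p = 0 := fun p hp => by
    simpa [unitIndex, h0 p hp] using h p hp (unitIndex 0 0 2)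
  have h4 := pd_u_eq_zero_and hU hψ h3 h0
  cases c
  exacts [absurd rfl hct, absurd rfl hcx, h4.1, h4.2, h1, h2, h3]

/-- The pairs of coordinates with respect to which the functions
`a(t) u_t + b(t,x) u_x + c(t,y) u_y + d(t,x,y,u)` can have a nonzero second derivative. The
coefficients of the third-order coordinates force a characteristic to be of this form. -/
def affineVary : J1Coord → J1Coord → Bool
  | .ut, c => c = .t
  | .ux, c => c = .t || c = .x
  | .uy, c => c = .t || c = .y
  | .x, .ut => false
  | .y, .ut => false
  | .u, .ut => false
  | .y, .ux => false
  | .u, .ux => false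
  | .x, .uy => false
  | .u, .uy => false
  | _, _ => true

/-- `D_y φ_{u_t}`, `D_x φ_{u_t}`, `D_y φ_{u_x}` and `D_x φ_{u_y}` vanish, being coefficients of
third-order coordinates, for all values of the second-order coordinates. -/
theorem pd_pd_eq_zero_of_affineVary (hU : IsOpen U) (h : IsContactSymmetry U φ) (c d : J1Coord)
    (hcd : affineVary c d = false) : ∀ p ∈ U, pd c (pd d φ) p = 0 := by
  have hc := contDiffOn_pd hU h.1
  have H := fun p hp => thirdOrder_coeffs (p := p) hU h hp
  have uty := pd_eq_zero_of_tot₁_y hU (hc .ut) fun p hp q => (H p hp q).1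
  have utx := pd_eq_zero_of_tot₁_x hU (hc .ut) fun p hp q => (H p hp q).2.1
  have uxy := pd_eq_zero_of_tot₁_y hU (hc .ux) fun p hp q => (H p hp q).2.2.1
  have uyx := pd_eq_zero_of_tot₁_x hU (hc .uy) fun p hp q => (H p hp q).2.2.2.1
  have comm : ∀ {c d}, (∀ p ∈ U, pd c (pd d φ) p = 0) → ∀ p ∈ U, pd d (pd c φ) p = 0 :=
    fun h0 p hp => (pd_comm hU h.1 hp _ _).trans (h0 p hp)
  cases c <;> cases d <;> first
    | exact absurd hcd (by decide)
    | exact uty _ (by decide) (by decide)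
    | exact utx _ (by decide) (by decide)
    | exact uxy _ (by decide) (by decide)
    | exact uyx _ (by decide) (by decide)
    | exact comm (uty _ (by decide) (by decide))
    | exact comm (utx _ (by decide) (by decide))
    | exact comm (uxy _ (by decide) (by decide))
    | exact comm (uyx _ (by decide) (by decide))

/-- The part of the invariance condition without third-order coordinates. -/
theorem invariance_secondOrder (hU : IsOpen U) (h : IsContactSymmetry U φ) (hp : p ∈ U)
    (q : ℕ → ℕ → ℕ → ℝ) :
      cubic φ .t .x .y (mkJet p q 0) - p .ux * cubic φ .x .y .y (mkJet p q 0)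
      + p .uy * cubic φ .x .x .y (mkJet p q 0)
      + q 0 1 1 * tot₁ (pd .u φ) .t (mkJet p q 0) + q 1 0 1 * tot₁ (pd .u φ) .x (mkJet p q 0)
      + q 1 1 0 * tot₁ (pd .u φ) .y (mkJet p q 0)
      - p .ux * (q 0 0 2 * tot₁ (pd .u φ) .x (mkJet p q 0)
        + 2 * (q 0 1 1 * tot₁ (pd .u φ) .y (mkJet p q 0)))
      + p .uy * (2 * (q 0 1 1 * tot₁ (pd .u φ) .x (mkJet p q 0))
        + q 0 2 0 * tot₁ (pd .u φ) .y (mkJet p q 0)) = 0 := by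
  have := invariance_mkJet hU h hp q 0 (by simp)
  simp only [Pi.zero_apply, zero_mul, add_zero] at this
  linear_combination this

theorem sum_vel_x_mkJet (q : ℕ → ℕ → ℕ → ℝ) (f : J1Coord → ℝ) :
    ∑ c, vel .x c.toJet (mkJet p q 0) * f c = f .x + p .ux * f .u + q 1 1 0 * f .ut
      + q 0 2 0 * f .ux + q 0 1 1 * f .uy := sum_vel_x f

theorem sum_vel_y_mkJet (q : ℕ → ℕ → ℕ → ℝ) (f : J1Coord → ℝ) :
    ∑ c, vel .y c.toJet (mkJet p q 0) * f c = f .y + p .uy * f .u + q 1 0 1 * f .ut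
      + q 0 1 1 * f .ux + q 0 0 2 * f .uy := sum_vel_y f

/-- The coefficients of `u_{tx}` and `u_{ty}` in the invariance condition show that `φ_u` depends on
`t` only. -/
theorem pd_pd_u_eq_zero (hU : IsOpen U) (h : IsContactSymmetry U φ) (c : J1Coord) (hc : c ≠ .t) :
    ∀ p ∈ U, pd c (pd .u φ) p = 0 := by
  have hA := pd_pd_eq_zero_of_affineVary hU h
  have hT := fun p hp => pd_pd_pd_eq_zero (p := p) hU h.1 hA hp
  have hy : ∀ p ∈ U, pd .y (pd .u φ) p + p .uy * pd .u (pd .u φ) p = 0 := by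
    intro p hp
    have h0 := invariance_secondOrder hU h hp 0
    have h1 := invariance_secondOrder hU h hp (unitIndex 1 1 0)
    simp [cubic, sum_vel_x_mkJet, sum_vel_y_mkJet, tot₁_mkJet_t, tot₁_mkJet_x,
      tot₁_mkJet_y, unitIndex, hT p hp, hA _ _ _ p hp, affineVary] at h0 h1
    linear_combination h1 - h0
  have hx : ∀ p ∈ U, pd .x (pd .u φ) p + p .ux * pd .u (pd .u φ) p = 0 := by
    intro p hp
    have h0 := invariance_secondOrder hU h hp 0
    have h1 := invariance_secondOrder hU h hp (unitIndex 1 0 1)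
    simp [cubic, sum_vel_x_mkJet, sum_vel_y_mkJet, tot₁_mkJet_t, tot₁_mkJet_x,
      tot₁_mkJet_y, unitIndex, hT p hp, hA _ _ _ p hp, affineVary] at h0 h1
    linear_combination h1 - h0
  have hux := hA .ux .u rfl
  have huy := hA .uy .u rfl
  have hx' := pd_u_eq_zero_and hU (contDiffOn_pd hU h.1 .u) hux hx
  have hy' := pd_u_eq_zero_and hU (contDiffOn_pd hU h.1 .u) huy hy
  cases c
  exacts [absurd rfl hc, hx'.1, hy'.1, hx'.2, hA .ut .u rfl, hux, huy]

/-- The relation `affineVary` with the pairs removed in which `u` is combined with a coordinate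
other than `t`; it describes the case `d = e(t) u + f(t,x,y)`. -/
def scalingVary (c d : J1Coord) : Bool :=
  affineVary c d && (c ≠ .u || d = .t) && (d ≠ .u || c = .t)

theorem pd_pd_eq_zero_of_scalingVary (hU : IsOpen U) (h : IsContactSymmetry U φ) (c d : J1Coord)
    (hcd : scalingVary c d = false) : ∀ p ∈ U, pd c (pd d φ) p = 0 := by
  intro p hp
  by_cases h1 : affineVary c d = false
  · exact pd_pd_eq_zero_of_affineVary hU h c d h1 p hp
  by_cases h2 : d = .u ∧ c ≠ .t
  · obtain ⟨rfl, h2⟩ := h2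
    exact pd_pd_u_eq_zero hU h c h2 p hp
  by_cases h3 : c = .u ∧ d ≠ .t
  · obtain ⟨rfl, h3⟩ := h3
    rw [pd_comm hU h.1 hp]
    exact pd_pd_u_eq_zero hU h d h3 p hp
  simp [scalingVary] at hcd
  grind

/-- A polynomial of degree one in `u_x` and `u_y` vanishes only if its coefficients do. -/
theorem coeffs_eq_zero (hU : IsOpen U) {A B C : J1 → ℝ} (hA : ContDiffOn ℝ ∞ A U)
    (hB : ContDiffOn ℝ ∞ B U) (hC : ContDiffOn ℝ ∞ C U)
    (h : ∀ p ∈ U, A p + p .ux * B p + p .uy * C p = 0)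
    (h0 : ∀ p ∈ U, ∀ l : J1Coord, l = .ux ∨ l = .uy →
      pd l A p = 0 ∧ pd l B p = 0 ∧ pd l C p = 0) :
    ∀ p ∈ U, A p = 0 ∧ B p = 0 ∧ C p = 0 := by
  intro p hp
  have key : ∀ l : J1Coord, _ := fun l =>
    (((hasPd_pd hU hA hp l).add ((hasPd_coord .ux).mul (hasPd_pd hU hB hp l))).add
      ((hasPd_coord .uy).mul (hasPd_pd hU hC hp l))).pd_eq.symm.trans
      (pd_eq_zero_of_eq_zero hU h l hp)
  have hx := key .ux
  have hy := key .uy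
  simp [h0 p hp .ux (by simp)] at hx
  simp [h0 p hp .uy (by simp)] at hy
  have := h p hp
  rw [hx, hy] at this
  exact ⟨by simpa using this, hx, hy⟩

/-- A cyclic instance of the symmetry of third derivatives. -/
theorem pd_rotate (hU : IsOpen U) (hφ : ContDiffOn ℝ ∞ φ U) (hp : p ∈ U) (a b c : J1Coord) :
    pd a (pd b (pd c φ)) p = pd b (pd c (pd a φ)) p := by
  rw [pd_comm hU (contDiffOn_pd hU hφ c) hp, pd_congr hU hp fun q hq => pd_comm hU hφ hq a c]

theorem scalingVary_eq_false_or (c d : J1Coord) (h : mayVary c d = false) :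
    scalingVary c d = false ∨ (c = .x ∧ d = .x) ∨ (c = .y ∧ d = .y) ∨ (c = .t ∧ d = .u) ∨
      (c = .u ∧ d = .t) := by
  revert c d
  decide

set_option maxHeartbeats 800000 in
/-- Besides the vanishing second derivatives found so far, the determining equations come from the
coefficients of `u_{xyy}`, `u_{xxy}`, `u_{xy}` and `1` in the invariance condition, separated by
powers of `u_x` and `u_y`. -/
theorem IsContactSymmetry.determining (hU : IsOpen U) (h : IsContactSymmetry U φ) :
    Determining U φ := by
  have hc := contDiffOn_pd hU h.1
  have hcc := fun c d => contDiffOn_pd hU (hc c) d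
  have hccc := fun c d e => contDiffOn_pd hU (hcc c d) e
  have hB := pd_pd_eq_zero_of_scalingVary hU h
  have hT := fun p hp => pd_pd_pd_eq_zero (p := p) hU h.1 hB hp
  have hT4 : ∀ p ∈ U, ∀ a e d c,
      (scalingVary a d && scalingVary d c && scalingVary a c) = false →
      pd a (pd e (pd d (pd c φ))) p = 0 := by
    intro p hp a e d c hz
    rw [pd_comm hU (hcc c d) hp]
    exact pd_eq_zero_of_eq_zero hU (fun q hq => hT q hq a d c hz) e hp
  have eq0 : ∀ p ∈ U, pd .t (pd .x (pd .y φ)) p - p .ux * pd .x (pd .y (pd .y φ)) p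
      + p .uy * pd .x (pd .x (pd .y φ)) p = 0 := by
    intro p hp
    have h0 := invariance_secondOrder hU h hp 0
    simp [cubic, sum_vel_x_mkJet, sum_vel_y_mkJet, tot₁_mkJet_t, tot₁_mkJet_x,
      tot₁_mkJet_y, hT p hp, hB _ _ _ p hp, affineVary, scalingVary] at h0
    linear_combination h0
  -- the coefficient of `u_{xy}`
  have eqxy : ∀ p ∈ U, (pd .t (pd .u φ) p + pd .t (pd .x (pd .ux φ)) p
      + pd .t (pd .y (pd .uy φ)) p) + p .ux * (-1 * pd .y (pd .y (pd .uy φ)) p)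
      + p .uy * pd .x (pd .x (pd .ux φ)) p = 0 := by
    intro p hp
    have h0 := eq0 p hp
    have h1 := invariance_secondOrder hU h hp (unitIndex 0 1 1)
    rw [← pd_rotate hU h.1 hp .uy .y .y,
      ← pd_congr hU hp fun q hq => pd_comm hU h.1 hq .uy .y]
    simp [cubic, sum_vel_x_mkJet, sum_vel_y_mkJet, tot₁_mkJet_t, tot₁_mkJet_x,
      tot₁_mkJet_y, unitIndex, hT p hp, hB _ _ _ p hp, affineVary, scalingVary] at h1
    linear_combination h1 - h0
  have hcoef := coeffs_eq_zero hU (((hcc .u .t).add (hccc .ux .x .t)).add (hccc .uy .y .t))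
    (contDiffOn_const.mul (hccc .uy .y .y)) (hccc .ux .x .x) eqxy (by
      intro p hp l hl
      have hA : pd l (fun p => pd .t (pd .u φ) p + pd .t (pd .x (pd .ux φ)) p
          + pd .t (pd .y (pd .uy φ)) p) p = _ :=
        (((hasPd_pd hU (hcc .u .t) hp l).add (hasPd_pd hU (hccc .ux .x .t) hp l)).add
          (hasPd_pd hU (hccc .uy .y .t) hp l)).pd_eq
      have hB' : pd l (fun p => -1 * pd .y (pd .y (pd .uy φ)) p) p = _ :=
        ((hasPd_pd hU (hccc .uy .y .y) hp l).const_mul (-1)).pd_eq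
      refine ⟨hA.trans ?_, hB'.trans ?_, ?_⟩ <;> rcases hl with rfl | rfl
      all_goals
        simp [hT p hp, hT4 p hp, scalingVary, affineVary])
  have yyuy : ∀ p ∈ U, pd .y (pd .y (pd .uy φ)) p = 0 := fun p hp => by
    simpa using (hcoef p hp).2.1
  have xxux : ∀ p ∈ U, pd .x (pd .x (pd .ux φ)) p = 0 := fun p hp => (hcoef p hp).2.2
  have third := fun p hp => (thirdOrder_coeffs (p := p) hU h hp 0).2.2.2.2
  simp only [tot₁_mkJet_t, tot₁_mkJet_x, tot₁_mkJet_y, Pi.zero_apply, zero_mul, add_zero] at third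
  -- the coefficients of `u_{xyy}` and `u_{xxy}`
  have exyy : ∀ p ∈ U, pd .t (pd .uy φ) p - pd .x φ p - p .ux * pd .u φ p
      + p .ux * (pd .t (pd .ut φ) p - pd .y (pd .uy φ) p) = 0 := fun p hp => by
    have := (third p hp).1
    rw [hB .u .uy rfl p hp, hB .u .ut rfl p hp] at this
    linear_combination this
  have exxy : ∀ p ∈ U, pd .t (pd .ux φ) p + pd .y φ p + p .uy * pd .u φ p
      + p .uy * (pd .x (pd .ux φ) p - pd .t (pd .ut φ) p) = 0 := fun p hp => by
    have := (third p hp).2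
    rw [hB .u .ux rfl p hp, hB .u .ut rfl p hp] at this
    linear_combination this
  -- the `u_x`-derivative of `exyy`
  have t_ut : ∀ p ∈ U, pd .t (pd .ut φ) p
      = pd .u φ p + pd .x (pd .ux φ) p + pd .y (pd .uy φ) p := by
    intro p hp
    have e := ((((hasPd_pd hU (hcc .uy .t) hp .ux).sub (hasPd_pd hU (hc .x) hp .ux)).sub
      ((hasPd_coord .ux).mul (hasPd_pd hU (hc .u) hp .ux))).add
      ((hasPd_coord .ux).mul ((hasPd_pd hU (hcc .ut .t) hp .ux).sub
        (hasPd_pd hU (hcc .uy .y) hp .ux)))).pd_eq.symm.trans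
      (pd_eq_zero_of_eq_zero hU exyy .ux hp)
    rw [pd_comm hU h.1 hp .ux .x] at e
    simp [hT p hp, hB _ _ _ p hp, affineVary, scalingVary] at e
    linear_combination e
  have t_uy : ∀ p ∈ U, pd .t (pd .uy φ) p = pd .x φ p - p .ux * pd .x (pd .ux φ) p :=
    fun p hp => by linear_combination exyy p hp - p .ux * t_ut p hp
  have t_ux : ∀ p ∈ U, pd .t (pd .ux φ) p = - pd .y φ p + p .uy * pd .y (pd .uy φ) p :=
    fun p hp => by linear_combination exxy p hp + p .uy * t_ut p hp
  have xx : ∀ p ∈ U, pd .x (pd .x φ) p = 0 := by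
    intro p hp
    have e := pd_congr (c := .x) hU hp t_uy
    rw [((hasPd_pd hU (hc .x) hp .x).sub
      ((hasPd_coord .ux).mul (hasPd_pd hU (hcc .ux .x) hp .x))).pd_eq] at e
    simp [hT p hp, xxux p hp, affineVary, scalingVary] at e
    exact e.symm
  have yy : ∀ p ∈ U, pd .y (pd .y φ) p = 0 := by
    intro p hp
    have e := pd_congr (c := .y) hU hp t_ux
    rw [((hasPd_pd hU (hc .y) hp .y).neg.add
      ((hasPd_coord .uy).mul (hasPd_pd hU (hcc .uy .y) hp .y))).pd_eq] at e
    simp [hT p hp, yyuy p hp, affineVary, scalingVary] at e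
    exact e
  -- the `y`-derivative of `t_uy` and the `x`-derivative of `t_ux` cancel in the coefficient of `u_{xy}`
  have tu : ∀ p ∈ U, pd .t (pd .u φ) p = 0 := by
    intro p hp
    have ey := pd_congr (c := .y) hU hp t_uy
    rw [((hasPd_pd hU (hc .x) hp .y).sub
      ((hasPd_coord .ux).mul (hasPd_pd hU (hcc .ux .x) hp .y))).pd_eq,
      pd_comm hU (hc .uy) hp, pd_comm hU h.1 hp .y .x] at ey
    have ex := pd_congr (c := .x) hU hp t_ux
    rw [((hasPd_pd hU (hc .y) hp .x).neg.add
      ((hasPd_coord .uy).mul (hasPd_pd hU (hcc .uy .y) hp .x))).pd_eq,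
      pd_comm hU (hc .ux) hp] at ex
    simp [hT p hp, affineVary, scalingVary] at ex ey
    linear_combination (hcoef p hp).1 - ex - ey
  refine ⟨fun c d hcd p hp => ?_, t_ut, t_uy, t_ux, fun p hp => ?_⟩
  · rcases scalingVary_eq_false_or c d hcd with
      hz | ⟨rfl, rfl⟩ | ⟨rfl, rfl⟩ | ⟨rfl, rfl⟩ | ⟨rfl, rfl⟩
    · exact hB c d hz p hp
    · exact xx p hp
    · exact yy p hp
    · exact tu p hp
    · rw [pd_comm hU h.1 hp]
      exact tu p hp
  · have e := eq0 p hp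
    rw [pd_eq_zero_of_eq_zero hU yy .x hp, ← pd_rotate hU h.1 hp .y .x .x,
      pd_eq_zero_of_eq_zero hU xx .y hp] at e
    linear_combination e

end Necessity

/-! ### Solutions of the determining equations are contact symmetries -/

section Sufficiency

variable {U : Set J1} {φ ψ : J1 → ℝ} {p : J1}

/-- By the determining equations, together with the `y`- and `x`-derivatives of two of them, the
result of applying the prolonged contact field to `F` is a multiple of `F`. -/
theorem Determining.isContactSymmetry (hU : IsOpen U) (hφ : ContDiffOn ℝ ∞ φ U)
    (h : Determining U φ) : IsContactSymmetry U φ := by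
  refine ⟨hφ, fun θ hθ hF => ?_⟩
  have hc := contDiffOn_pd hU hφ
  have hcc := fun c d => contDiffOn_pd hU (hc c) d
  have hT := fun p hp => pd_pd_pd_eq_zero (p := p) hU hφ h.zero hp
  have hZ := fun c d hcd => h.zero c d hcd _ hθ
  rw [F_eq] at hF
  rw [contactLift_F_eq hU hφ hθ]
  -- these two make the remaining third derivatives of `φ` cancel
  have ey := pd_congr (c := .y) hU hθ h.t_uy
  rw [((hasPd_pd hU (hc .x) hθ .y).sub
    ((hasPd_coord .ux).mul (hasPd_pd hU (hcc .ux .x) hθ .y))).pd_eq,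
    pd_comm hU (hc .uy) hθ, pd_comm hU hφ hθ .y .x] at ey
  have ex := pd_congr (c := .x) hU hθ h.t_ux
  rw [((hasPd_pd hU (hc .y) hθ .x).neg.add
    ((hasPd_coord .uy).mul (hasPd_pd hU (hcc .uy .y) hθ .x))).pd_eq,
    pd_comm hU (hc .ux) hθ] at ex
  simp only [cubic, tot₁, sum_vel_t, sum_vel_x, sum_vel_y]
  simp [hT _ hθ, hZ, mayVary, hZ .u _ rfl, h.txy _ hθ] at ex ey ⊢
  rw [pd_congr hU hθ fun q hq => pd_comm hU hφ hq .uy .y, ey, ex, h.t_ut _ hθ, h.t_uy _ hθ,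
    h.t_ux _ hθ]
  have eux : proj1 θ .ux = θ (.u 0 1 0) := rfl
  have euy : proj1 θ .uy = θ (.u 0 0 1) := rfl
  rw [eux, euy]
  linear_combination (2 * pd .u φ (proj1 θ) + 2 * pd .x (pd .ux φ) (proj1 θ)
    + 2 * pd .y (pd .uy φ) (proj1 θ)) * hF

end Sufficiency

/-! ### The general solution of the determining equations -/

section GeneralSolution

variable {U : Set J1} {φ ψ : J1 → ℝ} {p : J1} {c₁ c₂ c₃ c₄ c₅ : ℝ} {A₁ A₂ A₃ : ℝ → ℝ}

/-- The general element of the span of the generators. -/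
noncomputable def generalSolution (c₁ c₂ c₃ c₄ c₅ : ℝ) (A₁ A₂ A₃ : ℝ → ℝ) (p : J1) : ℝ :=
  c₁ * phi1 p + c₂ * phi2 p + c₃ * phi3 p + c₄ * phi4 p + c₅ * phi5 p
    + phi6 A₁ p + phi7 A₂ p + phi8 A₃ p

theorem generalSolution_eq (q : J1) : generalSolution c₁ c₂ c₃ c₄ c₅ A₁ A₂ A₃ q =
    -c₁ * (q .t * q .ut) + (2 * c₅ - c₁) * q .u - c₂ * q .ut - (c₃ + c₅) * (q .x * q .ux)
      + (c₃ - c₅) * (q .y * q .uy)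
      + c₄ * (q .x * q .y - q .t * (q .x * q .ux) + q .t * (q .y * q .uy))
      - A₁ (q .t) * q .ux + deriv A₁ (q .t) * q .y - A₂ (q .t) * q .uy - deriv A₂ (q .t) * q .x
      + A₃ (q .t) := by
  simp only [generalSolution, phi1, phi2, phi3, phi4, phi5, phi6, phi7, phi8]
  ring

/-- The first derivatives of `generalSolution`. -/
noncomputable def generalSolutionPd (c₁ c₂ c₃ c₄ c₅ : ℝ) (A₁ A₂ A₃ : ℝ → ℝ) :
    J1Coord → J1 → ℝ
  | .t, p => -c₁ * p .ut + c₄ * (p .y * p .uy - p .x * p .ux) - deriv A₁ (p .t) * p .ux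
      + deriv (deriv A₁) (p .t) * p .y - deriv A₂ (p .t) * p .uy
      - deriv (deriv A₂) (p .t) * p .x + deriv A₃ (p .t)
  | .x, p => -(c₃ + c₅) * p .ux + c₄ * p .y - c₄ * (p .t * p .ux) - deriv A₂ (p .t)
  | .y, p => (c₃ - c₅) * p .uy + c₄ * p .x + c₄ * (p .t * p .uy) + deriv A₁ (p .t)
  | .u, _ => 2 * c₅ - c₁
  | .ut, p => -c₁ * p .t - c₂
  | .ux, p => -(c₃ + c₅) * p .x - c₄ * (p .t * p .x) - A₁ (p .t)
  | .uy, p => (c₃ - c₅) * p .y + c₄ * (p .t * p .y) - A₂ (p .t)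

theorem hasPd_generalSolution (hU : IsOpen U) (h₁ : ContDiffOn ℝ ∞ A₁ (times U))
    (h₂ : ContDiffOn ℝ ∞ A₂ (times U)) (h₃ : ContDiffOn ℝ ∞ A₃ (times U)) (hp : p ∈ U)
    (c : J1Coord) : HasPd (generalSolution c₁ c₂ c₃ c₄ c₅ A₁ A₂ A₃) c p
      (generalSolutionPd c₁ c₂ c₃ c₄ c₅ A₁ A₂ A₃ c p) := by
  have co : ∀ d : J1Coord, HasPd (fun q : J1 => q d) c p (if c = d then 1 else 0) := hasPd_coord
  have comp : ∀ {A : ℝ → ℝ}, ContDiffOn ℝ ∞ A (times U) →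
      HasPd (fun q : J1 => A (q .t)) c p (if c = .t then deriv A (p .t) else 0) :=
    fun hA => hasPd_comp_coord (differentiableAt_of_times hU hA hp)
  have d₁ := contDiffOn_deriv_times hU h₁
  have d₂ := contDiffOn_deriv_times hU h₂
  have key := ((((((((((((co .t).mul (co .ut)).const_mul (-c₁)).add
    ((co .u).const_mul (2 * c₅ - c₁))).sub ((co .ut).const_mul c₂)).sub
    (((co .x).mul (co .ux)).const_mul (c₃ + c₅))).add
    (((co .y).mul (co .uy)).const_mul (c₃ - c₅))).add
    (((((co .x).mul (co .y)).sub ((co .t).mul ((co .x).mul (co .ux)))).add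
      ((co .t).mul ((co .y).mul (co .uy)))).const_mul c₄)).sub
    ((comp h₁).mul (co .ux))).add ((comp d₁).mul (co .y))).sub
    ((comp h₂).mul (co .uy))).sub ((comp d₂).mul (co .x))).add (comp h₃)
  rw [← funext generalSolution_eq] at key
  convert key using 1
  cases c <;> simp only [generalSolutionPd, reduceCtorEq, ↓reduceIte] <;> ring

theorem contDiffOn_generalSolution (hU : IsOpen U) (h₁ : ContDiffOn ℝ ∞ A₁ (times U))
    (h₂ : ContDiffOn ℝ ∞ A₂ (times U)) (h₃ : ContDiffOn ℝ ∞ A₃ (times U)) :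
    ContDiffOn ℝ ∞ (generalSolution c₁ c₂ c₃ c₄ c₅ A₁ A₂ A₃) U := by
  have e₁ := contDiffOn_comp_t h₁
  have e₂ := contDiffOn_comp_t h₂
  have e₃ := contDiffOn_comp_t h₃
  have d₁ := contDiffOn_comp_t (contDiffOn_deriv_times hU h₁)
  have d₂ := contDiffOn_comp_t (contDiffOn_deriv_times hU h₂)
  have co : ∀ d : J1Coord, ContDiffOn ℝ ∞ (fun q : J1 => q d) U := fun d =>
    (contDiff_apply ℝ ℝ d).contDiffOn
  rw [funext generalSolution_eq]
  have k : ∀ k : ℝ, ContDiffOn ℝ ∞ (fun _ : J1 => k) U := fun k => contDiffOn_const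
  exact (((((((((((k _).mul ((co .t).mul (co .ut))).add
    ((k _).mul (co .u))).sub ((k _).mul (co .ut))).sub
    ((k _).mul ((co .x).mul (co .ux)))).add
    ((k _).mul ((co .y).mul (co .uy)))).add
    ((k _).mul ((((co .x).mul (co .y)).sub ((co .t).mul ((co .x).mul (co .ux)))).add
      ((co .t).mul ((co .y).mul (co .uy)))))).sub
    (e₁.mul (co .ux))).add (d₁.mul (co .y))).sub
    (e₂.mul (co .uy))).sub (d₂.mul (co .x))).add e₃

theorem determining_of_eq_generalSolution (hU : IsOpen U) (h₁ : ContDiffOn ℝ ∞ A₁ (times U))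
    (h₂ : ContDiffOn ℝ ∞ A₂ (times U)) (h₃ : ContDiffOn ℝ ∞ A₃ (times U))
    (hφ : ∀ p ∈ U, φ p = generalSolution c₁ c₂ c₃ c₄ c₅ A₁ A₂ A₃ p) : Determining U φ := by
  have hsm : ContDiffOn ℝ ∞ φ U := (contDiffOn_generalSolution hU h₁ h₂ h₃).congr hφ
  have hpd : ∀ c, ∀ p ∈ U, pd c φ p = generalSolutionPd c₁ c₂ c₃ c₄ c₅ A₁ A₂ A₃ c p :=
    fun c p hp => ((hasPd_generalSolution hU h₁ h₂ h₃ hp c).congr hU hp hφ).pd_eq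
  have d₁ := contDiffOn_deriv_times hU h₁
  have d₂ := contDiffOn_deriv_times hU h₂
  have co : ∀ (p : J1) (c d : J1Coord), HasPd (fun q : J1 => q d) c p (if c = d then 1 else 0) :=
    fun _ _ => hasPd_coord
  have comp : ∀ {A : ℝ → ℝ}, ContDiffOn ℝ ∞ A (times U) → ∀ p ∈ U, ∀ c : J1Coord,
      HasPd (fun q : J1 => A (q .t)) c p (if c = .t then deriv A (p .t) else 0) :=
    fun hA p hp c => hasPd_comp_coord (differentiableAt_of_times hU hA hp)
  have hx := fun p hp c => ((((((co p c .ux).const_mul (-(c₃ + c₅))).add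
    ((co p c .y).const_mul c₄)).sub (((co p c .t).mul (co p c .ux)).const_mul c₄)).sub
    (comp d₂ p hp c)).congr hU hp (hpd .x)).pd_eq
  have hy := fun p hp c => ((((((co p c .uy).const_mul (c₃ - c₅)).add
    ((co p c .x).const_mul c₄)).add (((co p c .t).mul (co p c .uy)).const_mul c₄)).add
    (comp d₁ p hp c)).congr hU hp (hpd .y)).pd_eq
  have hu := fun p hp c => ((hasPd_const (c := c) (p := p) (2 * c₅ - c₁)).congr hU hp
    (hpd .u)).pd_eq
  have hut := fun p hp c => ((((co p c .t).const_mul (-c₁)).sub (hasPd_const c₂)).congr hU hp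
    (hpd .ut)).pd_eq
  have hux := fun p hp c => (((((co p c .x).const_mul (-(c₃ + c₅))).sub
    (((co p c .t).mul (co p c .x)).const_mul c₄)).sub (comp h₁ p hp c)).congr hU hp
    (hpd .ux)).pd_eq
  have huy := fun p hp c => (((((co p c .y).const_mul (c₃ - c₅)).add
    (((co p c .t).mul (co p c .y)).const_mul c₄)).sub (comp h₂ p hp c)).congr hU hp
    (hpd .uy)).pd_eq
  refine ⟨fun c d hcd p hp => ?_, fun p hp => ?_, fun p hp => ?_, fun p hp => ?_,
    fun p hp => ?_⟩
  · cases d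
    case t =>
      rw [pd_comm hU hsm hp]
      cases c <;> first
        | exact absurd hcd (by decide)
        | exact hu p hp .t
    case x => rw [hx p hp]; cases c <;> first | exact absurd hcd (by decide) | simp
    case y => rw [hy p hp]; cases c <;> first | exact absurd hcd (by decide) | simp
    case u => exact hu p hp c
    case ut => rw [hut p hp]; cases c <;> first | exact absurd hcd (by decide) | simp
    case ux => rw [hux p hp]; cases c <;> first | exact absurd hcd (by decide) | simp
    case uy => rw [huy p hp]; cases c <;> first | exact absurd hcd (by decide) | simp
  · rw [hut p hp, hpd .u p hp, hux p hp, huy p hp]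
    simp [generalSolutionPd]
    ring
  · rw [huy p hp, hpd .x p hp, hux p hp]
    simp [generalSolutionPd]
    ring
  · rw [hux p hp, hpd .y p hp, huy p hp]
    simp [generalSolutionPd]
    ring
  · refine ((hasPd_const c₄).congr hU hp fun q hq => ?_).pd_eq
    rw [hy q hq]
    simp

/-- The solutions of the determining equations. Convexity of `U` turns the vanishing of partial
derivatives into global constancy; `φ_u`, `φ_{xy}` and `φ_{t u_t}` are constant, which leaves the
gradient of `φ` determined up to constants and functions of `t`. -/
theorem Determining.exists_eq_generalSolution (hU : IsOpen U) (hconv : Convex ℝ U)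
    (hφ : ContDiffOn ℝ ∞ φ U) (h : Determining U φ) :
    ∃ (c₁ c₂ c₃ c₄ c₅ : ℝ) (A₁ A₂ A₃ : ℝ → ℝ), ContDiffOn ℝ ∞ A₁ (times U) ∧
      ContDiffOn ℝ ∞ A₂ (times U) ∧ ContDiffOn ℝ ∞ A₃ (times U) ∧
      ∀ p ∈ U, φ p = generalSolution c₁ c₂ c₃ c₄ c₅ A₁ A₂ A₃ p := by
  have hc := contDiffOn_pd hU hφ
  have hcc := fun c d => contDiffOn_pd hU (hc c) d
  have hT := fun p hp => pd_pd_pd_eq_zero (p := p) hU hφ h.zero hp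
  have co : ∀ (p : J1) (c d : J1Coord), HasPd (fun q : J1 => q d) c p (if c = d then 1 else 0) :=
    fun _ _ => hasPd_coord
  have cco : ∀ d : J1Coord, ContDiffOn ℝ ∞ (fun q : J1 => q d) U := fun d =>
    (contDiff_apply ℝ ℝ d).contDiffOn
  have k : ∀ k : ℝ, ContDiffOn ℝ ∞ (fun _ : J1 => k) U := fun k => contDiffOn_const
  have comp : ∀ {A : ℝ → ℝ}, ContDiffOn ℝ ∞ A (times U) → ∀ p ∈ U, ∀ c : J1Coord,
      HasPd (fun q : J1 => A (q .t)) c p (if c = .t then deriv A (p .t) else 0) :=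
    fun hA p hp c => hasPd_comp_coord (differentiableAt_of_times hU hA hp)
  -- `φ_u` and `φ_xy` are constant
  obtain ⟨e, he⟩ := exists_eq_const hU hconv (hc .u) fun c p hp => by
    rw [← pd_comm hU hφ hp .u c]
    by_cases hct : c = .t
    · subst hct; exact h.zero .u .t rfl p hp
    · exact h.zero _ _ rfl p hp
  obtain ⟨m, hm⟩ := exists_eq_const hU hconv (hcc .y .x) fun c p hp => by
    by_cases hct : c = .t
    · subst hct; exact h.txy p hp
    · exact hT p hp _ _ _ (by revert hct; revert c; decide)
  -- `φ_xux + m t` is constant, since `φ_tux = -φ_y + u_y φ_yuy`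
  have htxux : ∀ p ∈ U, pd .t (pd .x (pd .ux φ)) p = -m := by
    intro p hp
    have ex := pd_congr (c := .x) hU hp h.t_ux
    rw [((hasPd_pd hU (hc .y) hp .x).neg.add
      ((hasPd_coord .uy).mul (hasPd_pd hU (hcc .uy .y) hp .x))).pd_eq,
      pd_comm hU (hc .ux) hp, hm p hp, hT p hp .x .y .uy rfl] at ex
    simpa using ex
  have htyuy : ∀ p ∈ U, pd .t (pd .y (pd .uy φ)) p = m := by
    intro p hp
    have ey := pd_congr (c := .y) hU hp h.t_uy
    rw [((hasPd_pd hU (hc .x) hp .y).sub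
      ((hasPd_coord .ux).mul (hasPd_pd hU (hcc .ux .x) hp .y))).pd_eq,
      pd_comm hU (hc .uy) hp, pd_comm hU hφ hp .y .x, hm p hp, hT p hp .y .x .ux rfl] at ey
    simpa using ey
  obtain ⟨k₀, hk₀⟩ := exists_eq_const hU hconv ((hcc .ux .x).add ((k m).mul (cco .t)))
    fun c p hp => by
      refine ((hasPd_pd hU (hcc .ux .x) hp c).add ((co p c .t).const_mul m)).pd_eq.trans ?_
      by_cases hct : c = .t
      · subst hct; simp [htxux p hp]
      · rw [hT p hp _ _ _ (by revert hct; revert c; decide)]; simp [hct]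
  have hxux : ∀ p ∈ U, pd .x (pd .ux φ) p = k₀ - m * p .t := fun p hp => by
    linear_combination hk₀ p hp
  -- `φ_tut` is constant, and `φ_ut` is affine in `t`
  obtain ⟨a₁, ha₁⟩ := exists_eq_const hU hconv (hcc .ut .t) fun c p hp => by
    by_cases hct : c = .t
    · subst hct
      rw [pd_congr hU hp h.t_ut, (((hasPd_pd hU (hc .u) hp .t).add
        (hasPd_pd hU (hcc .ux .x) hp .t)).add (hasPd_pd hU (hcc .uy .y) hp .t)).pd_eq,
        h.zero .t .u rfl p hp, htxux p hp, htyuy p hp]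
      ring
    · exact hT p hp _ _ _ (by revert hct; revert c; decide)
  obtain ⟨a₀, ha₀⟩ := exists_eq_const hU hconv ((hc .ut).sub ((k a₁).mul (cco .t)))
    fun c p hp => by
      refine ((hasPd_pd hU (hc .ut) hp c).sub ((co p c .t).const_mul a₁)).pd_eq.trans ?_
      by_cases hct : c = .t
      · subst hct; simp [ha₁ p hp]
      · rw [h.zero c .ut (by revert hct; revert c; decide) p hp]; simp [hct]
  have hut : ∀ p ∈ U, pd .ut φ p = a₁ * p .t + a₀ := fun p hp => by
    linear_combination ha₀ p hp
  have hyuy : ∀ p ∈ U, pd .y (pd .uy φ) p = a₁ - e - k₀ + m * p .t := fun p hp => by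
    linear_combination ha₁ p hp - h.t_ut p hp - he p hp - hxux p hp
  -- `φ_ux` and `φ_uy` up to functions of `t`
  obtain ⟨B, hB, hBeq⟩ := exists_eq_comp_t hU hconv
    ((hc .ux).sub (((k k₀).sub ((k m).mul (cco .t))).mul (cco .x))) fun c hct p hp => by
      refine ((hasPd_pd hU (hc .ux) hp c).sub (((hasPd_const k₀).sub
        ((co p c .t).const_mul m)).mul (co p c .x))).pd_eq.trans ?_
      by_cases hcx : c = .x
      · subst hcx; simp [hxux p hp]
      · rw [h.zero c .ux (by revert hct hcx; revert c; decide) p hp]; simp [hct, hcx]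
  obtain ⟨C, hC, hCeq⟩ := exists_eq_comp_t hU hconv
    ((hc .uy).sub (((k (a₁ - e - k₀)).add ((k m).mul (cco .t))).mul (cco .y))) fun c hct p hp => by
      refine ((hasPd_pd hU (hc .uy) hp c).sub (((hasPd_const (a₁ - e - k₀)).add
        ((co p c .t).const_mul m)).mul (co p c .y))).pd_eq.trans ?_
      by_cases hcy : c = .y
      · subst hcy; simp [hyuy p hp]
      · rw [h.zero c .uy (by revert hct hcy; revert c; decide) p hp]; simp [hct, hcy]
  have hux : ∀ p ∈ U, pd .ux φ p = (k₀ - m * p .t) * p .x + B (p .t) := fun p hp => by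
    linear_combination hBeq p hp
  have huy : ∀ p ∈ U, pd .uy φ p = (a₁ - e - k₀ + m * p .t) * p .y + C (p .t) := fun p hp => by
    linear_combination hCeq p hp
  have htux : ∀ p ∈ U, pd .t (pd .ux φ) p = -m * p .x + deriv B (p .t) := fun p hp => by
    rw [pd_congr hU hp hux, ((((hasPd_const k₀).sub ((co p .t .t).const_mul m)).mul
      (co p .t .x)).add (comp hB p hp .t)).pd_eq]
    simp
  have htuy : ∀ p ∈ U, pd .t (pd .uy φ) p = m * p .y + deriv C (p .t) := fun p hp => by
    rw [pd_congr hU hp huy, ((((hasPd_const _).add ((co p .t .t).const_mul m)).mul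
      (co p .t .y)).add (comp hC p hp .t)).pd_eq]
    simp
  -- the difference of `φ` and its part without `A₃` depends on `t` only
  have hnB : ContDiffOn ℝ ∞ (fun t => -B t) (times U) := hB.neg
  have hnC : ContDiffOn ℝ ∞ (fun t => -C t) (times U) := hC.neg
  have h0 : ContDiffOn ℝ ∞ (fun _ : ℝ => (0 : ℝ)) (times U) := contDiffOn_const
  obtain ⟨A₃, hA₃, hA₃eq⟩ := exists_eq_comp_t hU hconv (hφ.sub (contDiffOn_generalSolution
    (c₁ := -a₁) (c₂ := -a₀) (c₃ := -k₀ - (e - a₁) / 2) (c₄ := m) (c₅ := (e - a₁) / 2)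
    hU hnB hnC h0)) fun c hct p hp => by
      refine ((hasPd_pd hU hφ hp c).sub (hasPd_generalSolution hU hnB hnC h0 hp c)).pd_eq.trans ?_
      have dB : deriv (fun t => -B t) (p .t) = - deriv B (p .t) := deriv.fun_neg
      have dC : deriv (fun t => -C t) (p .t) = - deriv C (p .t) := deriv.fun_neg
      cases c
      case t => exact absurd rfl hct
      case x =>
        simp only [generalSolutionPd, dC]
        linear_combination htuy p hp - h.t_uy p hp + p .ux * hxux p hp
      case y =>
        simp only [generalSolutionPd, dB]
        linear_combination h.t_ux p hp - htux p hp + p .uy * hyuy p hp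
      case u => simp only [generalSolutionPd]; linear_combination he p hp
      case ut => simp only [generalSolutionPd]; linear_combination hut p hp
      case ux => simp only [generalSolutionPd]; linear_combination hux p hp
      case uy => simp only [generalSolutionPd]; linear_combination huy p hp
  refine ⟨-a₁, -a₀, -k₀ - (e - a₁) / 2, m, (e - a₁) / 2, fun t => -B t, fun t => -C t, A₃,
    hnB, hnC, hA₃, fun p hp => ?_⟩
  have := hA₃eq p hp
  rw [generalSolution_eq] at this ⊢
  linear_combination this

end GeneralSolution

/-! ### The Lie algebra of contact symmetries -/

section LieAlgebra

variable {U : Set J1} {φ ψ : J1 → ℝ}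

/-- The contact symmetries are the linear combinations of the generators. -/
theorem isContactSymmetry_iff (hU : IsOpen U) (hconv : Convex ℝ U) :
    IsContactSymmetry U φ ↔
      ∃ (c₁ c₂ c₃ c₄ c₅ : ℝ) (A₁ A₂ A₃ : ℝ → ℝ), ContDiffOn ℝ ∞ A₁ (times U) ∧
        ContDiffOn ℝ ∞ A₂ (times U) ∧ ContDiffOn ℝ ∞ A₃ (times U) ∧
        ∀ p ∈ U, φ p = generalSolution c₁ c₂ c₃ c₄ c₅ A₁ A₂ A₃ p := by
  refine ⟨fun h => (h.determining hU).exists_eq_generalSolution hU hconv h.1, ?_⟩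
  rintro ⟨c₁, c₂, c₃, c₄, c₅, A₁, A₂, A₃, h₁, h₂, h₃, h⟩
  exact (determining_of_eq_generalSolution hU h₁ h₂ h₃ h).isContactSymmetry hU
    ((contDiffOn_generalSolution hU h₁ h₂ h₃).congr h)

theorem IsContactSymmetry.linear_combination (hU : IsOpen U) (hconv : Convex ℝ U)
    (hφ : IsContactSymmetry U φ) (hψ : IsContactSymmetry U ψ) (a b : ℝ) :
    IsContactSymmetry U fun p => a * φ p + b * ψ p := by
  obtain ⟨c₁, c₂, c₃, c₄, c₅, A₁, A₂, A₃, hA₁, hA₂, hA₃, h⟩ :=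
    (isContactSymmetry_iff hU hconv).1 hφ
  obtain ⟨d₁, d₂, d₃, d₄, d₅, B₁, B₂, B₃, hB₁, hB₂, hB₃, h'⟩ :=
    (isContactSymmetry_iff hU hconv).1 hψ
  have hab : ∀ {A B : ℝ → ℝ}, ContDiffOn ℝ ∞ A (times U) → ContDiffOn ℝ ∞ B (times U) →
      ContDiffOn ℝ ∞ (fun t => a * A t + b * B t) (times U) := fun hA hB =>
    (contDiffOn_const.mul hA).add (contDiffOn_const.mul hB)
  refine (isContactSymmetry_iff hU hconv).2 ⟨a * c₁ + b * d₁, a * c₂ + b * d₂, a * c₃ + b * d₃,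
    a * c₄ + b * d₄, a * c₅ + b * d₅, _, _, _, hab hA₁ hB₁, hab hA₂ hB₂, hab hA₃ hB₃,
    fun p hp => ?_⟩
  have hd : ∀ {A B : ℝ → ℝ}, ContDiffOn ℝ ∞ A (times U) → ContDiffOn ℝ ∞ B (times U) →
      deriv (fun t => a * A t + b * B t) (p .t) = a * deriv A (p .t) + b * deriv B (p .t) :=
    fun hA hB => (((differentiableAt_of_times hU hA hp).hasDerivAt.const_mul a).add
      ((differentiableAt_of_times hU hB hp).hasDerivAt.const_mul b)).deriv
  rw [h p hp, h' p hp, generalSolution_eq, generalSolution_eq, generalSolution_eq, hd hA₁ hB₁,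
    hd hA₂ hB₂]
  ring

theorem IsContactSymmetry.jacobiBracket (hU : IsOpen U) (hconv : Convex ℝ U)
    (hφ : IsContactSymmetry U φ) (hψ : IsContactSymmetry U ψ) :
    IsContactSymmetry U (jacobiBracket φ ψ) := by
  obtain ⟨c₁, c₂, c₃, c₄, c₅, A₁, A₂, A₃, hA₁, hA₂, hA₃, h⟩ :=
    (isContactSymmetry_iff hU hconv).1 hφ
  obtain ⟨d₁, d₂, d₃, d₄, d₅, B₁, B₂, B₃, hB₁, hB₂, hB₃, h'⟩ :=
    (isContactSymmetry_iff hU hconv).1 hψ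
  have ht : ∀ k l : ℝ, ContDiffOn ℝ ∞ (fun t : ℝ => k * t + l) (times U) := fun k l =>
    ((contDiff_const.mul contDiff_id).add contDiff_const).contDiffOn
  have hA₁' := contDiffOn_deriv_times hU hA₁
  have hA₂' := contDiffOn_deriv_times hU hA₂
  have hA₃' := contDiffOn_deriv_times hU hA₃
  have hB₁' := contDiffOn_deriv_times hU hB₁
  have hB₂' := contDiffOn_deriv_times hU hB₂
  have hB₃' := contDiffOn_deriv_times hU hB₃
  -- the coefficients of `{φ, ψ}`, read off from those of `u`, `u_t`, `u_x`, `u_y`, `x y` and `1`;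
  -- the linear factors are those of `u_t`, `x u_x`, `y u_y` and `u` in `φ` and `ψ`
  refine (isContactSymmetry_iff hU hconv).2 ⟨0, c₂ * d₁ - c₁ * d₂, c₂ * d₄ - d₂ * c₄,
    c₁ * d₄ - d₁ * c₄, 0,
    fun t => (-d₁ * t + -d₂) * deriv A₁ t - (-c₁ * t + -c₂) * deriv B₁ t
      + (-c₄ * t + -(c₃ + c₅)) * B₁ t - (-d₄ * t + -(d₃ + d₅)) * A₁ t,
    fun t => (-d₁ * t + -d₂) * deriv A₂ t - (-c₁ * t + -c₂) * deriv B₂ t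
      + (c₄ * t + (c₃ - c₅)) * B₂ t - (d₄ * t + (d₃ - d₅)) * A₂ t,
    fun t => (-d₁ * t + -d₂) * deriv A₃ t - (-c₁ * t + -c₂) * deriv B₃ t
      + (0 * t + (2 * d₅ - d₁)) * A₃ t - (0 * t + (2 * c₅ - c₁)) * B₃ t
      + A₂ t * deriv B₁ t - A₁ t * deriv B₂ t + deriv A₂ t * B₁ t - deriv A₁ t * B₂ t,
    ?_, ?_, ?_, fun p hp => ?_⟩
  · exact ((((ht _ _).mul hA₁').sub ((ht _ _).mul hB₁')).add ((ht _ _).mul hB₁)).sub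
      ((ht _ _).mul hA₁)
  · exact ((((ht _ _).mul hA₂').sub ((ht _ _).mul hB₂')).add ((ht _ _).mul hB₂)).sub
      ((ht _ _).mul hA₂)
  · exact ((((((((ht _ _).mul hA₃').sub ((ht _ _).mul hB₃')).add ((ht _ _).mul hA₃)).sub
      ((ht _ _).mul hB₃)).add (hA₂.mul hB₁')).sub (hA₁.mul hB₂')).add (hA₂'.mul hB₁)).sub
      (hA₁'.mul hB₂)
  · have dt : ∀ k l : ℝ, HasDerivAt (fun t : ℝ => k * t + l) k (p .t) := fun k l => by
      simpa using ((hasDerivAt_id (p .t)).const_mul k).add_const l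
    have dd : ∀ {A : ℝ → ℝ}, ContDiffOn ℝ ∞ A (times U) →
        HasDerivAt A (deriv A (p .t)) (p .t) := fun hA =>
      (differentiableAt_of_times hU hA hp).hasDerivAt
    have hd : ∀ {A B : ℝ → ℝ}, ContDiffOn ℝ ∞ A (times U) → ContDiffOn ℝ ∞ B (times U) →
        ∀ k₁ l₁ k₂ l₂ k₃ l₃ k₄ l₄ : ℝ,
        deriv (fun t => (k₁ * t + l₁) * deriv A t - (k₂ * t + l₂) * deriv B t
          + (k₃ * t + l₃) * B t - (k₄ * t + l₄) * A t) (p .t) = _ :=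
      fun hA hB k₁ l₁ k₂ l₂ k₃ l₃ k₄ l₄ =>
        (((((dt k₁ l₁).mul (dd (contDiffOn_deriv_times hU hA))).sub
          ((dt k₂ l₂).mul (dd (contDiffOn_deriv_times hU hB)))).add
          ((dt k₃ l₃).mul (dd hB))).sub ((dt k₄ l₄).mul (dd hA))).deriv
    have pdφ : ∀ c, pd c φ p = _ := fun c =>
      ((hasPd_generalSolution hU hA₁ hA₂ hA₃ hp c).congr hU hp h).pd_eq
    have pdψ : ∀ c, pd c ψ p = _ := fun c =>
      ((hasPd_generalSolution hU hB₁ hB₂ hB₃ hp c).congr hU hp h').pd_eq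
    rw [generalSolution_eq, hd hA₁ hB₁, hd hA₂ hB₂]
    simp only [EulerVorticity.jacobiBracket, pdφ, pdψ, generalSolutionPd, h p hp, h' p hp,
      generalSolution_eq]
    ring

end LieAlgebra

end EulerVorticity

theorem proposition3 (U : Set EulerVorticity.J1) (hU : IsOpen U) (hconv : Convex ℝ U) :
    -- the contact symmetries over `U` are exactly the combinations of the listed generators
    (∀ φ : EulerVorticity.J1 → ℝ,
      EulerVorticity.IsContactSymmetry U φ ↔
        ∃ (c₁ c₂ c₃ c₄ c₅ : ℝ) (A₁ A₂ A₃ : ℝ → ℝ),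
          ContDiffOn ℝ ∞ A₁ (EulerVorticity.times U) ∧
          ContDiffOn ℝ ∞ A₂ (EulerVorticity.times U) ∧
          ContDiffOn ℝ ∞ A₃ (EulerVorticity.times U) ∧
          ∀ p ∈ U, φ p =
            c₁ * EulerVorticity.phi1 p + c₂ * EulerVorticity.phi2 p + c₃ * EulerVorticity.phi3 p
              + c₄ * EulerVorticity.phi4 p + c₅ * EulerVorticity.phi5 p
              + EulerVorticity.phi6 A₁ p + EulerVorticity.phi7 A₂ p + EulerVorticity.phi8 A₃ p) ∧
    -- and they form a Lie algebra under the Jacobi bracket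
    (∀ φ ψ : EulerVorticity.J1 → ℝ,
      EulerVorticity.IsContactSymmetry U φ → EulerVorticity.IsContactSymmetry U ψ →
        (∀ a b : ℝ, EulerVorticity.IsContactSymmetry U (fun p => a * φ p + b * ψ p)) ∧
        EulerVorticity.IsContactSymmetry U (EulerVorticity.jacobiBracket φ ψ)) :=
  ⟨fun _ => EulerVorticity.isContactSymmetry_iff hU hconv, fun _ _ hφ hψ =>
    ⟨hφ.linear_combination hU hconv hψ, hφ.jacobiBracket hU hconv hψ⟩⟩
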